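/- Let $N\ge 0$. Suppose given a categorical action of the shifted $q=0$ affine algebra $\dot{\mathcal U}_{0,N}(L\mathfrak{sl}_2)$: a triangulated, $\mathbb C$-linear, idempotent complete 2-category $\mathcal K$ (categories of 1-morphisms are triangulated, composition is exact in each variable, spaces of 2-morphisms are finite dimensional) with objects $\mathcal K(k)=\mathcal K(k,N-k)$, $0\le k\le N$, which are themselves triangulated categories on which the 1-morphisms act as exact functors, exactly in the 1-morphism (put $\mathcal K(k)=0$ for other $k$), and 1-morphisms $E_r1_k:\mathcal K(k)\to\mathcal K(k-1)$ $(-k-1\le r\le 0)$, $F_s1_k:\mathcal K(k)\to\mathcal K(k+1)$ $(0\le s\le N-k+1)$, invertible $\Psi^{\pm}1_k$ and $H_{\pm1}1_k$ on $\mathcal K(k)$, such that on each $\mathcal K(k)$, $0\le k\le N$, and whenever all indices are in range (superscripts $R$, $L$ denote right and left adjoints): * $(H_1)^L\cong H_{-1}\cong (H_1)^R$; all $(\Psi^\pm)^{\pm1}$ commute with each other, $H_1$ and $H_{-1}$ commute, and $H_{\pm1}$ commute with $\Psi^{\pm}$; * $(E_r1_k)^R\cong(\Psi^+)^{r+1}F_{N-k+2}(\Psi^+)^{-r-2}[-r-1]$,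 $(E_r1_k)^L\cong(\Psi^-)^{r+k-1}F_0(\Psi^-)^{-r-k}[r+k]$, $(F_s1_k)^R\cong(\Psi^-)^{-s+1}E_{-k-2}(\Psi^-)^{s-2}[s-1]$, $(F_s1_k)^L\cong(\Psi^+)^{-s+N-k-1}E_0(\Psi^+)^{s-N+k}[-s+N-k]$; * $E_{r+1}E_s\cong E_{s+1}E_r[-1]$ if $r>s$, $\cong 0$ if $r=s$, $\cong E_{s+1}E_r[1]$ if $r<s$; $F_rF_{s+1}\cong F_sF_{r+1}[1]$ if $r>s$, $\cong0$ if $r=s$, $\cong F_sF_{r+1}[-1]$ if $r<s$; * $\Psi^{\pm}E_r\cong E_{r+1}\Psi^{\pm}[\mp1]$ and $\Psi^\pm F_s\cong F_{s-1}\Psi^\pm[\pm1]$; * there are exact triangles $H_1E_r\to E_rH_1\to E_{r+1}\oplus E_{r+1}[1]$, $E_rH_{-1}\to H_{-1}E_r\to E_{r-1}\oplus E_{r-1}[1]$, $F_sH_1\to H_1F_s\to F_{s+1}\oplus F_{s+1}[1]$, $H_{-1}F_s\to F_sH_{-1}\to F_{s-1}\oplus F_{s-1}[1]$; * on $\mathcal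 K(k)$ there are exact triangles $F_sE_r\to E_rF_s\to \Psi^+H_1$ if $r+s=N-k+1$, $F_sE_r\to E_rF_s\to\Psi^+$ if $r+s=N-k$, $E_rF_s\to F_sE_r\to\Psi^-$ if $r+s=-k$, $E_rF_s\to F_sE_r\to\Psi^-H_{-1}$ if $r+s=-k-1$, and $F_sE_r\cong E_rF_s$ if $-k+1\le r+s\le N-k-1$. For $0\le k\le N$ let $P(N-k,k)$ be the set of sequences $N-k\ge\lambda_1\ge\dots\ge\lambda_k\ge0$, let $F_\lambda=F_{\lambda_1}\cdots F_{\lambda_k}1_0$ and $\varphi_k=\bigoplus_{\lambda\in P(N-k,k)}F_\lambda:\mathcal K(0)\to\mathcal K(k)$. Assume that $\mathcal K(0)$ is equipped with a t-structure and that for every $1\le k\le N$: 1. the image of $\varphi_k$ weakly generates $\mathcal K(k)$, i.e. $Y=0$ whenever $\mathrm{Hom}(\varphi_k(X)[n],Y)=0$ for all $X$ and $n\in\mathbb Z$; 2. $(F_\lambda)^RF_{\lambda'}$ is t-exact for all $\lambda,\lambda'\in P(N-k,k)$; 3. the right adjoint $\Phi=(\varphi_k)^R$ extends to cocomplete categories: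 there are cocomplete triangulated categories $\widetilde{\mathcal C}\supset\mathcal K(k)$, $\widetilde{\mathcal D}\supset\mathcal K(0)$ containing these as full triangulated subcategories, and an exact functor $\widetilde\Phi:\widetilde{\mathcal C}\to\widetilde{\mathcal D}$ that restricts to $\Phi$, commutes with small coproducts, has a left adjoint sending $\mathcal K(0)$ into $\mathcal K(k)$, and satisfies $\widetilde\Phi(X)\in\mathcal K(0)\Rightarrow X\in\mathcal K(k)$ (membership up to isomorphism). Put $\varphi'_k=(\Psi^-)^{N-k}(\Psi^+)^k\varphi_k[k(N-k)-N]:\mathcal K(0)\to\mathcal K(k)$ for $0\le k\le N$. Then $\varphi'_k$ has a right adjoint, and for every $0\le k\le N$ there is a t-structure on $\mathcal K(k)$ with $$\mathcal K(k)'^{\le0}=\{X: (\varphi'_k)^R(X)\in\mathcal K(0)^{\le0}\},\qquad \mathcal K(k)'^{\ge0}=\{X: (\varphi'_k)^R(X)\in\mathcal K(0)^{\ge0}\},$$ where $\mathcal K(0)^{\le 0},\mathcal K(0)^{\ge0}$ refer to the given t-structure. With respect to these t-structures (on $\mathcal K(0)$ too one uses the one induced by $\varphi'_0$), the left adjoints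 $(F_{N-k-1}1_k)^L:\mathcal K(k+1)\to\mathcal K(k)$ exist and are t-exact for $0\le k\le N-1$, and the left adjoints $(E_01_k)^L$ exist and $(E_01_k)^L\,\Psi^-[k-2]:\mathcal K(k-1)\to\mathcal K(k)$ is t-exact for $1\le k\le N$. -/

import Mathlib

open CategoryTheory CategoryTheory.Limits CategoryTheory.Pretriangulated
open CategoryTheory.Triangulated (TStructure)

universe w v u v₁ u₁ v' u'

namespace ShiftedAffine

noncomputable section

/-! ### General notions about triangulated categories -/

section General

variable {C : Type*} [Category* C] [Preadditive C] [HasZeroObject C] [HasShift C ℤ]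
  [∀ n : ℤ, (shiftFunctor C n).Additive] [Pretriangulated C]
  {D : Type*} [Category* D] [Preadditive D] [HasZeroObject D] [HasShift D ℤ]
  [∀ n : ℤ, (shiftFunctor D n).Additive] [Pretriangulated D]

/-- The objects `X`, `Y`, `Z` are the vertices of an exact triangle `X ⟶ Y ⟶ Z ⟶ X⟦1⟧`. -/
def ExactTriangle (X Y Z : C) : Prop :=
  ∃ (f : X ⟶ Y) (g : Y ⟶ Z) (h : Z ⟶ X⟦(1 : ℤ)⟧), Triangle.mk f g h ∈ distTriang C

/-- A family of objects weakly generates `C` if any `Y` with `Hom (X s⟦n⟧, Y) = 0` for all `s`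
and all `n : ℤ` is zero. -/
def WeaklyGenerates {ι : Type*} (X : ι → C) : Prop :=
  ∀ Y : C, (∀ (s : ι) (n : ℤ) (f : (X s)⟦n⟧ ⟶ Y), f = 0) → IsZero Y

/-- t-exactness of a functor between triangulated categories equipped with t-structures:
it preserves the objects `≤ 0` and the objects `≥ 0`. (The notion is applied below only to
composites of exact functors and of adjoints of exact functors, which are exact.) -/
def IsTExact (t₁ : TStructure C) (t₂ : TStructure D) (G : C ⥤ D) : Prop :=
  (∀ X : C, t₁.le 0 X → t₂.le 0 (G.obj X)) ∧ (∀ X : C, t₁.ge 0 X → t₂.ge 0 (G.obj X))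

set_option linter.checkUnivs false in
/-- An extension of `Φ : C ⥤ D` to an exact functor `Φ' : C' ⥤ D'` between cocomplete
triangulated categories, which commutes with small coproducts and has a left adjoint `L'`.
The categories `C` and `D` are embedded in `C'` and `D'` as full triangulated subcategories
such that `L'` maps `D` to `C`, and an object `X` of `C'` belongs to `C`
as soon as `Φ' X` belongs to `D`. -/
structure CocompleteExtension (Φ : C ⥤ D) where
  /-- the cocomplete triangulated category containing the source -/
  C' : Type u'
  [catC : Category.{v'} C']
  [preaddC : Preadditive C']
  [zeroC : HasZeroObject C']
  [shiftC : HasShift C' ℤ]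
  [shiftAddC : ∀ n : ℤ, (shiftFunctor C' n).Additive]
  [pretriC : Pretriangulated C']
  [triC : CategoryTheory.IsTriangulated C']
  [coprodC : HasCoproducts.{v'} C']
  /-- the cocomplete triangulated category containing the target -/
  D' : Type u'
  [catD : Category.{v'} D']
  [preaddD : Preadditive D']
  [zeroD : HasZeroObject D']
  [shiftD : HasShift D' ℤ]
  [shiftAddD : ∀ n : ℤ, (shiftFunctor D' n).Additive]
  [pretriD : Pretriangulated D']
  [triD : CategoryTheory.IsTriangulated D']
  [coprodD : HasCoproducts.{v'} D']
  /-- the embedding of the source -/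
  ιC : C ⥤ C'
  [fullC : ιC.Full]
  [faithfulC : ιC.Faithful]
  [commShiftC : ιC.CommShift ℤ]
  [exactC : ιC.IsTriangulated]
  /-- the embedding of the target -/
  ιD : D ⥤ D'
  [fullD : ιD.Full]
  [faithfulD : ιD.Faithful]
  [commShiftD : ιD.CommShift ℤ]
  [exactD : ιD.IsTriangulated]
  /-- the extended functor -/
  Φ' : C' ⥤ D'
  [commShift : Φ'.CommShift ℤ]
  [exact : Φ'.IsTriangulated]
  preservesCoproducts : ∀ J : Type v', PreservesColimitsOfShape (Discrete J) Φ'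
  /-- the left adjoint of the extended functor -/
  L' : D' ⥤ C'
  adj : L' ⊣ Φ'
  /-- `Φ'` restricts to `Φ` -/
  iso : ιC ⋙ Φ' ≅ Φ ⋙ ιD
  left_mem : ∀ Y : D, ιC.essImage (L'.obj (ιD.obj Y))
  mem_of_mem : ∀ X : C', ιD.essImage (Φ'.obj X) → ιC.essImage X

end General

/-! ### Triangulated 2-categories -/

/-- A triangulated, `ℂ`-linear, idempotent complete 2-category: the categories of 1-morphisms
`a ⟶ b` are `ℂ`-linear, triangulated and idempotent complete, and the composition of 1-morphisms
is `ℂ`-linear and exact in each variable. -/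
class TriangulatedBicategory (B : Type u) [Bicategory.{w, v} B] where
  [preadditive : ∀ a b : B, Preadditive (a ⟶ b)]
  [linear : ∀ a b : B, Linear ℂ (a ⟶ b)]
  [hasZeroObject : ∀ a b : B, HasZeroObject (a ⟶ b)]
  [hasShift : ∀ a b : B, HasShift (a ⟶ b) ℤ]
  [shift_additive : ∀ (a b : B) (n : ℤ), (shiftFunctor (a ⟶ b) n).Additive]
  [shift_linear : ∀ (a b : B) (n : ℤ), (shiftFunctor (a ⟶ b) n).Linear ℂ]
  [pretriangulated : ∀ a b : B, Pretriangulated (a ⟶ b)]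
  [isTriangulated : ∀ a b : B, CategoryTheory.IsTriangulated (a ⟶ b)]
  [isIdempotentComplete : ∀ a b : B, IsIdempotentComplete (a ⟶ b)]
  [precomp_commShift : ∀ {a b : B} (c : B) (f : a ⟶ b), (Bicategory.precomp c f).CommShift ℤ]
  [precomp_exact : ∀ {a b : B} (c : B) (f : a ⟶ b), (Bicategory.precomp c f).IsTriangulated]
  [precomp_linear : ∀ {a b : B} (c : B) (f : a ⟶ b), (Bicategory.precomp c f).Linear ℂ]
  [postcomp_commShift : ∀ (a : B) {b c : B} (g : b ⟶ c), (Bicategory.postcomp a g).CommShift ℤ]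
  [postcomp_exact : ∀ (a : B) {b c : B} (g : b ⟶ c), (Bicategory.postcomp a g).IsTriangulated]
  [postcomp_linear : ∀ (a : B) {b c : B} (g : b ⟶ c), (Bicategory.postcomp a g).Linear ℂ]

attribute [reducible] TriangulatedBicategory.preadditive
  TriangulatedBicategory.linear
  TriangulatedBicategory.hasShift
  TriangulatedBicategory.pretriangulated
  TriangulatedBicategory.precomp_commShift
  TriangulatedBicategory.postcomp_commShift

attribute [instance] TriangulatedBicategory.preadditive TriangulatedBicategory.linear
  TriangulatedBicategory.hasZeroObject TriangulatedBicategory.hasShift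
  TriangulatedBicategory.shift_additive TriangulatedBicategory.shift_linear
  TriangulatedBicategory.pretriangulated TriangulatedBicategory.isTriangulated
  TriangulatedBicategory.isIdempotentComplete
  TriangulatedBicategory.precomp_commShift TriangulatedBicategory.precomp_exact
  TriangulatedBicategory.precomp_linear
  TriangulatedBicategory.postcomp_commShift TriangulatedBicategory.postcomp_exact
  TriangulatedBicategory.postcomp_linear

section Realization

variable {B : Type u} [Bicategory.{w, v} B]

/-- Given a pseudofunctor from `B` to categories and an object `X` of the category attached to
`a`, the functor sending a 1-morphism `f : a ⟶ b` to the value at `X` of the functor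
attached to `f`. -/
@[simps]
def evalAt (R : Pseudofunctor B Cat.{v₁, u₁}) {a : B} (b : B) (X : R.obj a) :
    (a ⟶ b) ⥤ R.obj b where
  obj f := (R.map f).toFunctor.obj X
  map η := (R.map₂ η).toNatTrans.app X

/-- The objects of a triangulated 2-category are themselves triangulated categories, and its
1-morphisms are exact functors between them: a pseudofunctor from `B` to categories
such that every object of `B` is sent to a `ℂ`-linear triangulated category, every
1-morphism to a `ℂ`-linear exact functor, and such that `f ↦ f X` is a `ℂ`-linear exact functor
from 1-morphisms to objects, for every object `X`. -/
class TriangulatedRealization [TriangulatedBicategory B]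
    (R : Pseudofunctor B Cat.{v₁, u₁}) where
  [preadditive : ∀ a : B, Preadditive (R.obj a)]
  [linear : ∀ a : B, Linear ℂ (R.obj a)]
  [hasZeroObject : ∀ a : B, HasZeroObject (R.obj a)]
  [hasShift : ∀ a : B, HasShift (R.obj a) ℤ]
  [shift_additive : ∀ (a : B) (n : ℤ), (shiftFunctor (R.obj a) n).Additive]
  [shift_linear : ∀ (a : B) (n : ℤ), (shiftFunctor (R.obj a) n).Linear ℂ]
  [pretriangulated : ∀ a : B, Pretriangulated (R.obj a)]
  [isTriangulated : ∀ a : B, CategoryTheory.IsTriangulated (R.obj a)]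
  [map_commShift : ∀ {a b : B} (f : a ⟶ b), (R.map f).toFunctor.CommShift ℤ]
  [map_exact : ∀ {a b : B} (f : a ⟶ b), (R.map f).toFunctor.IsTriangulated]
  [map_linear : ∀ {a b : B} (f : a ⟶ b), (R.map f).toFunctor.Linear ℂ]
  [eval_commShift : ∀ {a : B} (b : B) (X : R.obj a), (evalAt R b X).CommShift ℤ]
  [eval_exact : ∀ {a : B} (b : B) (X : R.obj a), (evalAt R b X).IsTriangulated]
  [eval_linear : ∀ {a : B} (b : B) (X : R.obj a), (evalAt R b X).Linear ℂ]

attribute [reducible] TriangulatedRealization.preadditive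
  TriangulatedRealization.linear
  TriangulatedRealization.hasShift
  TriangulatedRealization.pretriangulated
  TriangulatedRealization.map_commShift
  TriangulatedRealization.eval_commShift

attribute [instance] TriangulatedRealization.preadditive TriangulatedRealization.linear
  TriangulatedRealization.hasZeroObject TriangulatedRealization.hasShift
  TriangulatedRealization.shift_additive TriangulatedRealization.shift_linear
  TriangulatedRealization.pretriangulated TriangulatedRealization.isTriangulated
  TriangulatedRealization.map_commShift TriangulatedRealization.map_exact
  TriangulatedRealization.map_linear
  TriangulatedRealization.eval_commShift TriangulatedRealization.eval_exact
  TriangulatedRealization.eval_linear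

/-- Nonnegative powers of an endo-1-morphism. -/
def npow {a : B} (f : a ⟶ a) : ℕ → (a ⟶ a)
  | 0 => 𝟙 a
  | n + 1 => npow f n ≫ f

/-- Integral powers of an endo-1-morphism `f` with quasi-inverse `g`. -/
def zpow {a : B} (f g : a ⟶ a) : ℤ → (a ⟶ a)
  | Int.ofNat n => npow f n
  | Int.negSucc n => npow g (n + 1)

end Realization

/-! ### Categorical actions of the shifted `q = 0` affine algebra -/

/-- A sign. -/
inductive PM
  | plus
  | minus

/-- The integer `±1`. -/
def PM.val : PM → ℤ
  | PM.plus => 1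
  | PM.minus => -1

/-- The range of `r` for which `E_r` is a generator on the weight `(k, N - k)`. -/
def ERange (k r : ℤ) : Prop := -k - 1 ≤ r ∧ r ≤ 0

/-- The range of `s` for which `F_s` is a generator on the weight `(k, N - k)`. -/
def FRange (N : ℕ) (k s : ℤ) : Prop := 0 ≤ s ∧ s ≤ N - k + 1

/-- A categorical action of the shifted `q = 0` affine algebra of `sl₂` with highest weight
`(0, N)`. The object `wt k` is the weight `(k, N - k)`; by convention it is defined for
all `k : ℤ` and it is zero unless `0 ≤ k ≤ N`. A composite of generators is imposed to satisfy a
relation only for `0 ≤ k ≤ N` and when all the generators that occur are in range; the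
values `E r`, `F s` out of range play no role. Recall that `f ≫ g` is `g ∘ f`. -/
structure CategoricalAction (N : ℕ) (B : Type u) [Bicategory.{w, v} B]
    [TriangulatedBicategory B] where
  /-- the weight `(k, N - k)` -/
  wt : ℤ → B
  wt_zero : ∀ k : ℤ, ¬ (0 ≤ k ∧ k ≤ N) → IsZero (𝟙 (wt k))
  /-- `E_r 1_(k, N - k)`, with target the weight `(l, N - l)`, `l = k - 1` -/
  E (r : ℤ) {k l : ℤ} (h : l + 1 = k) : wt k ⟶ wt l
  /-- `F_s 1_(k, N - k)`, with target the weight `(l, N - l)`, `l = k + 1` -/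
  F (s : ℤ) {k l : ℤ} (h : k + 1 = l) : wt k ⟶ wt l
  /-- `Psi ε δ k` is `(Ψ^ε)^δ 1_(k, N - k)`, with `ε, δ` signs -/
  Psi (ε δ : PM) (k : ℤ) : wt k ⟶ wt k
  /-- `H_{±1} 1_(k, N - k)` -/
  H (ε : PM) (k : ℤ) : wt k ⟶ wt k
  /-- spaces of maps between 1-morphisms are finite dimensional -/
  finiteDimensional_hom : ∀ (a b : B) (f g : a ⟶ b), FiniteDimensional ℂ (f ⟶ g)
  /-- `(Ψ^ε)^{-1}` is a quasi-inverse of `Ψ^ε` -/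
  Psi_inv : ∀ (ε δ₁ δ₂ : PM) (k : ℤ), 0 ≤ k → k ≤ N → δ₁ ≠ δ₂ →
    Nonempty (Psi ε δ₁ k ≫ Psi ε δ₂ k ≅ 𝟙 (wt k))
  /-- `H_{-1}` is right and left adjoint to `H_1` -/
  H_adj : ∀ (k : ℤ), 0 ≤ k → k ≤ N →
    Nonempty (Bicategory.Adjunction (H PM.plus k) (H PM.minus k)) ∧
      Nonempty (Bicategory.Adjunction (H PM.minus k) (H PM.plus k))
  /-- `(E_r)^R ≅ (Ψ^+)^{r+1} F_{N-k+2} (Ψ^+)^{-r-2} [-r-1]` -/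
  E_rightAdjoint : ∀ (k l : ℤ) (h : l + 1 = k) (r : ℤ), 0 ≤ k → k ≤ N → ERange k r →
    Nonempty (Bicategory.Adjunction (E r h)
      (((zpow (Psi PM.plus PM.plus l) (Psi PM.plus PM.minus l) (-r - 2) ≫ F (N - k + 2) h) ≫
        zpow (Psi PM.plus PM.plus k) (Psi PM.plus PM.minus k) (r + 1))⟦-r - 1⟧))
  /-- `(E_r)^L ≅ (Ψ^-)^{r+k-1} F_0 (Ψ^-)^{-r-k} [r+k]` -/
  E_leftAdjoint : ∀ (k l : ℤ) (h : l + 1 = k) (r : ℤ), 0 ≤ k → k ≤ N → ERange k r →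
    Nonempty (Bicategory.Adjunction
      (((zpow (Psi PM.minus PM.plus l) (Psi PM.minus PM.minus l) (-r - k) ≫ F 0 h) ≫
        zpow (Psi PM.minus PM.plus k) (Psi PM.minus PM.minus k) (r + k - 1))⟦r + k⟧)
      (E r h))
  /-- `(F_s)^R ≅ (Ψ^-)^{-s+1} E_{-k-2} (Ψ^-)^{s-2} [s-1]` -/
  F_rightAdjoint : ∀ (k l : ℤ) (h : k + 1 = l) (s : ℤ), 0 ≤ k → k ≤ N → FRange N k s →
    Nonempty (Bicategory.Adjunction (F s h)
      (((zpow (Psi PM.minus PM.plus l) (Psi PM.minus PM.minus l) (s - 2) ≫ E (-k - 2) h) ≫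
        zpow (Psi PM.minus PM.plus k) (Psi PM.minus PM.minus k) (-s + 1))⟦s - 1⟧))
  /-- `(F_s)^L ≅ (Ψ^+)^{-s+N-k-1} E_0 (Ψ^+)^{s-N+k} [-s+N-k]` -/
  F_leftAdjoint : ∀ (k l : ℤ) (h : k + 1 = l) (s : ℤ), 0 ≤ k → k ≤ N → FRange N k s →
    Nonempty (Bicategory.Adjunction
      (((zpow (Psi PM.plus PM.plus l) (Psi PM.plus PM.minus l) (s - N + k) ≫ E 0 h) ≫
        zpow (Psi PM.plus PM.plus k) (Psi PM.plus PM.minus k) (-s + N - k - 1))⟦-s + N - k⟧)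
      (F s h))
  /-- the `(Ψ^±)^{±1}` commute with each other -/
  Psi_Psi : ∀ (ε₁ δ₁ ε₂ δ₂ : PM) (k : ℤ), 0 ≤ k → k ≤ N →
    Nonempty (Psi ε₁ δ₁ k ≫ Psi ε₂ δ₂ k ≅ Psi ε₂ δ₂ k ≫ Psi ε₁ δ₁ k)
  /-- the `H_{±1}` commute with each other -/
  H_H : ∀ (ε₁ ε₂ : PM) (k : ℤ), 0 ≤ k → k ≤ N →
    Nonempty (H ε₁ k ≫ H ε₂ k ≅ H ε₂ k ≫ H ε₁ k)
  /-- the `H_{±1}` commute with the `Ψ^±` -/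
  H_Psi : ∀ (ε₁ ε₂ : PM) (k : ℤ), 0 ≤ k → k ≤ N →
    Nonempty (Psi ε₂ PM.plus k ≫ H ε₁ k ≅ H ε₁ k ≫ Psi ε₂ PM.plus k)
  /-- `E_{r+1} E_s ≅ E_{s+1} E_r [-1]` if `r > s` -/
  E_E_of_gt : ∀ (k l m : ℤ) (h₁ : l + 1 = k) (h₂ : m + 1 = l) (r s : ℤ), 0 ≤ k → k ≤ N →
    ERange k s → ERange l (r + 1) → ERange k r → ERange l (s + 1) → s < r →
    Nonempty (E s h₁ ≫ E (r + 1) h₂ ≅ (E r h₁ ≫ E (s + 1) h₂)⟦(-1 : ℤ)⟧)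
  /-- `E_{r+1} E_r ≅ 0` -/
  E_E_of_eq : ∀ (k l m : ℤ) (h₁ : l + 1 = k) (h₂ : m + 1 = l) (r : ℤ), 0 ≤ k → k ≤ N →
    ERange k r → ERange l (r + 1) → IsZero (E r h₁ ≫ E (r + 1) h₂)
  /-- `E_{r+1} E_s ≅ E_{s+1} E_r [1]` if `r < s` -/
  E_E_of_lt : ∀ (k l m : ℤ) (h₁ : l + 1 = k) (h₂ : m + 1 = l) (r s : ℤ), 0 ≤ k → k ≤ N →
    ERange k s → ERange l (r + 1) → ERange k r → ERange l (s + 1) → r < s →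
    Nonempty (E s h₁ ≫ E (r + 1) h₂ ≅ (E r h₁ ≫ E (s + 1) h₂)⟦(1 : ℤ)⟧)
  /-- `F_r F_{s+1} ≅ F_s F_{r+1} [1]` if `r > s` -/
  F_F_of_gt : ∀ (k l m : ℤ) (h₁ : k + 1 = l) (h₂ : l + 1 = m) (r s : ℤ), 0 ≤ k → k ≤ N →
    FRange N k (s + 1) → FRange N l r → FRange N k (r + 1) → FRange N l s → s < r →
    Nonempty (F (s + 1) h₁ ≫ F r h₂ ≅ (F (r + 1) h₁ ≫ F s h₂)⟦(1 : ℤ)⟧)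
  /-- `F_r F_{r+1} ≅ 0` -/
  F_F_of_eq : ∀ (k l m : ℤ) (h₁ : k + 1 = l) (h₂ : l + 1 = m) (r : ℤ), 0 ≤ k → k ≤ N →
    FRange N k (r + 1) → FRange N l r → IsZero (F (r + 1) h₁ ≫ F r h₂)
  /-- `F_r F_{s+1} ≅ F_s F_{r+1} [-1]` if `r < s` -/
  F_F_of_lt : ∀ (k l m : ℤ) (h₁ : k + 1 = l) (h₂ : l + 1 = m) (r s : ℤ), 0 ≤ k → k ≤ N →
    FRange N k (s + 1) → FRange N l r → FRange N k (r + 1) → FRange N l s → r < s →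
    Nonempty (F (s + 1) h₁ ≫ F r h₂ ≅ (F (r + 1) h₁ ≫ F s h₂)⟦(-1 : ℤ)⟧)
  /-- `Ψ^± E_r ≅ E_{r+1} Ψ^± [∓1]` -/
  Psi_E : ∀ (ε : PM) (k l : ℤ) (h : l + 1 = k) (r : ℤ), 0 ≤ k → k ≤ N →
    ERange k r → ERange k (r + 1) →
    Nonempty (E r h ≫ Psi ε PM.plus l ≅ (Psi ε PM.plus k ≫ E (r + 1) h)⟦-ε.val⟧)
  /-- `Ψ^± F_s ≅ F_{s-1} Ψ^± [±1]` -/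
  Psi_F : ∀ (ε : PM) (k l : ℤ) (h : k + 1 = l) (s : ℤ), 0 ≤ k → k ≤ N →
    FRange N k s → FRange N k (s - 1) →
    Nonempty (F s h ≫ Psi ε PM.plus l ≅ (Psi ε PM.plus k ≫ F (s - 1) h)⟦ε.val⟧)
  /-- `H_1 E_r ⟶ E_r H_1 ⟶ E_{r+1} ⊕ E_{r+1} [1]` -/
  H_E_plus : ∀ (k l : ℤ) (h : l + 1 = k) (r : ℤ), 0 ≤ k → k ≤ N →
    ERange k r → ERange k (r + 1) →
    ExactTriangle (E r h ≫ H PM.plus l) (H PM.plus k ≫ E r h)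
      (E (r + 1) h ⊞ (E (r + 1) h)⟦(1 : ℤ)⟧)
  /-- `E_r H_{-1} ⟶ H_{-1} E_r ⟶ E_{r-1} ⊕ E_{r-1} [1]` -/
  H_E_minus : ∀ (k l : ℤ) (h : l + 1 = k) (r : ℤ), 0 ≤ k → k ≤ N →
    ERange k r → ERange k (r - 1) →
    ExactTriangle (H PM.minus k ≫ E r h) (E r h ≫ H PM.minus l)
      (E (r - 1) h ⊞ (E (r - 1) h)⟦(1 : ℤ)⟧)
  /-- `F_s H_1 ⟶ H_1 F_s ⟶ F_{s+1} ⊕ F_{s+1} [1]` -/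
  H_F_plus : ∀ (k l : ℤ) (h : k + 1 = l) (s : ℤ), 0 ≤ k → k ≤ N →
    FRange N k s → FRange N k (s + 1) →
    ExactTriangle (H PM.plus k ≫ F s h) (F s h ≫ H PM.plus l)
      (F (s + 1) h ⊞ (F (s + 1) h)⟦(1 : ℤ)⟧)
  /-- `H_{-1} F_s ⟶ F_s H_{-1} ⟶ F_{s-1} ⊕ F_{s-1} [1]` -/
  H_F_minus : ∀ (k l : ℤ) (h : k + 1 = l) (s : ℤ), 0 ≤ k → k ≤ N →
    FRange N k s → FRange N k (s - 1) →
    ExactTriangle (F s h ≫ H PM.minus l) (H PM.minus k ≫ F s h)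
      (F (s - 1) h ⊞ (F (s - 1) h)⟦(1 : ℤ)⟧)
  /-- `F_s E_r ⟶ E_r F_s ⟶ Ψ^+ H_1` if `r + s = N - k + 1` -/
  E_F_a : ∀ (k l m : ℤ) (h₁ : l + 1 = k) (h₂ : k + 1 = m) (r s : ℤ), 0 ≤ k → k ≤ N →
    ERange k r → FRange N l s → FRange N k s → ERange m r → r + s = N - k + 1 →
    ExactTriangle (E r h₁ ≫ F s h₁) (F s h₂ ≫ E r h₂) (H PM.plus k ≫ Psi PM.plus PM.plus k)
  /-- `F_s E_r ⟶ E_r F_s ⟶ Ψ^+` if `r + s = N - k` -/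
  E_F_b : ∀ (k l m : ℤ) (h₁ : l + 1 = k) (h₂ : k + 1 = m) (r s : ℤ), 0 ≤ k → k ≤ N →
    ERange k r → FRange N l s → FRange N k s → ERange m r → r + s = N - k →
    ExactTriangle (E r h₁ ≫ F s h₁) (F s h₂ ≫ E r h₂) (Psi PM.plus PM.plus k)
  /-- `E_r F_s ⟶ F_s E_r ⟶ Ψ^-` if `r + s = -k` -/
  E_F_c : ∀ (k l m : ℤ) (h₁ : l + 1 = k) (h₂ : k + 1 = m) (r s : ℤ), 0 ≤ k → k ≤ N →
    ERange k r → FRange N l s → FRange N k s → ERange m r → r + s = -k →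
    ExactTriangle (F s h₂ ≫ E r h₂) (E r h₁ ≫ F s h₁) (Psi PM.minus PM.plus k)
  /-- `E_r F_s ⟶ F_s E_r ⟶ Ψ^- H_{-1}` if `r + s = -k - 1` -/
  E_F_d : ∀ (k l m : ℤ) (h₁ : l + 1 = k) (h₂ : k + 1 = m) (r s : ℤ), 0 ≤ k → k ≤ N →
    ERange k r → FRange N l s → FRange N k s → ERange m r → r + s = -k - 1 →
    ExactTriangle (F s h₂ ≫ E r h₂) (E r h₁ ≫ F s h₁)
      (H PM.minus k ≫ Psi PM.minus PM.plus k)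
  /-- `F_s E_r ≅ E_r F_s` if `-k + 1 ≤ r + s ≤ N - k - 1` -/
  E_F_e : ∀ (k l m : ℤ) (h₁ : l + 1 = k) (h₂ : k + 1 = m) (r s : ℤ), 0 ≤ k → k ≤ N →
    ERange k r → FRange N l s → FRange N k s → ERange m r →
    -k + 1 ≤ r + s → r + s ≤ N - k - 1 →
    Nonempty (E r h₁ ≫ F s h₁ ≅ F s h₂ ≫ E r h₂)

/-- The set `P(a, b)` of Young diagrams with at most `b` rows and first row at most `a`,
given by the lengths of the rows. -/
def YoungIn (a b : ℕ) : Type :=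
  {l : Fin b → ℕ // Antitone l ∧ ∀ i, l i ≤ a}

instance (a b : ℕ) : Finite (YoungIn a b) := by
  have : Function.Injective
      (fun (l : YoungIn a b) (i : Fin b) => (⟨l.1 i, Nat.lt_succ_of_le (l.2.2 i)⟩ : Fin (a + 1))) :=
    fun l l' h => Subtype.ext (funext fun i => congrArg Fin.val (congrFun h i))
  exact Finite.of_injective _ this

namespace CategoricalAction

variable {N : ℕ} {B : Type u} [Bicategory.{w, v} B] [TriangulatedBicategory B]
  (A : CategoricalAction N B)

/-- The weight `(k, N - k)` for a natural number `k`. -/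
abbrev ob (k : ℕ) : B := A.wt (k : ℤ)

/-- `F_s 1_(k, N - k)` for a natural number `k`. -/
abbrev Fn (s : ℤ) (k : ℕ) : A.ob k ⟶ A.ob (k + 1) := A.F s (Nat.cast_succ k).symm

/-- `E_r 1_(k + 1, N - k - 1)` for a natural number `k`. -/
abbrev En (r : ℤ) (k : ℕ) : A.ob (k + 1) ⟶ A.ob k := A.E r (Nat.cast_succ k).symm

/-- `F_{l 0} F_{l 1} ⋯ F_{l (k - 1)} 1_(0, N)`. -/
def Fword : ∀ (k : ℕ), (Fin k → ℕ) → (A.ob 0 ⟶ A.ob k)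
  | 0, _ => 𝟙 _
  | k + 1, l => Fword k (fun i => l i.succ) ≫ A.Fn (l 0) k

/-- `φ_k`, the direct sum of the `F_λ 1_(0, N)` over all `λ ∈ P(N - k, k)`. -/
def φ (k : ℕ) : A.ob 0 ⟶ A.ob k :=
  ⨁ fun l : YoungIn (N - k) k => A.Fword k l.1

/-- `φ'_k = (Ψ^-)^{N-k} (Ψ^+)^k φ_k [k(N-k) - N]`. -/
def φ' (k : ℕ) : A.ob 0 ⟶ A.ob k :=
  ((A.φ k ≫ npow (A.Psi PM.plus PM.plus k) k) ≫
    npow (A.Psi PM.minus PM.plus k) (N - k))⟦(k : ℤ) * ((N : ℤ) - k) - N⟧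

end CategoricalAction

end

end ShiftedAffine

/-! Write `Φ` for the right adjoint of `φ_k`. Weak generation makes `Φ` conservative, and `Φ φ_k` is
a direct sum of functors `(F_λ)^R F_μ`, so it preserves `≤ 0`. Declare an object `≤ n` or `≥ n` when
its image under `Φ` is; only truncations need work. Given `X`, let `A ⟶ Φ X ⟶ W` be the truncation
triangle, with `A ≤ 0` and `W ≥ 1`, and replace `X` by the cone of the adjoint map `φ_k A ⟶ X`. Then
`W` is still the truncation of the new image, and the map of images factors through `W`
(`exists_truncation_step`). Iterating gives a sequence whose image has mapping telescope `W`
(`exists_iso_telescope`). The telescope exists in the cocomplete extension and lies in `K(k)`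
because its image `W` lies in `K(0)`. This is `exists_truncation`, and it yields
`exists_induced_tStructure`. Passing from `φ_k` to `φ'_k` only composes with an invertible
1-morphism (`Induces.comp`).

For exactness, let `m ⊣ l`. If `m φ'_a` is a retract of `φ'_b`, then taking right adjoints makes
`(φ'_a)^R l` a retract of `(φ'_b)^R`, so `l` is t-exact (`Induces.isTExact`). Both left adjoints in
the theorem, the second one twisted by `Ψ^-` and shifted, have left adjoints `m` of their own by the
adjunction formulas. After the powers of `Ψ^±` are moved across, `m` becomes `F_{N-k-1}` applied to
`φ_k`, respectively `E_0` applied to `φ_{k+1}`. These send each `F_λ` to zero or, up to an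
invertible factor, to another such word, injectively in `λ` (`nonempty_retract_φ_comp_F`,
`nonempty_retract_φ_comp_E`). The twist and the shift in `φ'_k` are what make the invertible factors
on the two sides agree. All of these identities are checked on isomorphism classes of 1-morphisms,
where shifts and powers of `Ψ^±` obey plain equations. -/

namespace ShiftedAffine

/-! ### Exact triangles given by their morphisms -/

section Triangles

variable {C : Type*} [Category* C] [Preadditive C] [HasZeroObject C] [HasShift C ℤ]
  [∀ n : ℤ, (shiftFunctor C n).Additive] [Pretriangulated C]
  {X Y Z : C} {f : X ⟶ Y} {g : Y ⟶ Z} {h : Z ⟶ X⟦(1 : ℤ)⟧}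

lemma exists_factor_mor₂ (hT : Triangle.mk f g h ∈ distTriang C) {W : C} (k : Y ⟶ W)
    (hk : f ≫ k = 0) : ∃ l : Z ⟶ W, k = g ≫ l :=
  Triangle.yoneda_exact₂ _ hT k hk

lemma exists_factor_mor₃ (hT : Triangle.mk f g h ∈ distTriang C) {W : C} (k : Z ⟶ W)
    (hk : g ≫ k = 0) : ∃ l : X⟦(1 : ℤ)⟧ ⟶ W, k = h ≫ l :=
  Triangle.yoneda_exact₃ _ hT k hk

lemma comp_eq_zero_of_distTriang (hT : Triangle.mk f g h ∈ distTriang C) : f ≫ g = 0 :=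
  comp_distTriang_mor_zero₁₂ _ hT

lemma epi_mor₂_iff (hT : Triangle.mk f g h ∈ distTriang C) : Epi g ↔ Mono f :=
  (Triangle.mor₃_eq_zero_iff_epi₂ _ hT).symm.trans (Triangle.mor₃_eq_zero_iff_mono₁ _ hT)

/-- Monomorphisms in a triangulated category split: the connecting map vanishes, so the identity of
`X` extends along `f`. -/
lemma exists_retraction (hT : Triangle.mk f g h ∈ distTriang C) [Mono f] :
    ∃ r : Y ⟶ X, f ≫ r = 𝟙 X := by
  have h0 : h = 0 := (Triangle.mor₃_eq_zero_iff_mono₁ _ hT).2 ‹_›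
  obtain ⟨r, hr⟩ := Triangle.yoneda_exact₂ _ (inv_rot_of_distTriang _ hT) (𝟙 X) (by
    subst h0
    change (-(((0 : Z ⟶ X⟦(1 : ℤ)⟧)⟦(-1 : ℤ)⟧') ≫
      (shiftFunctorCompIsoId C (1 : ℤ) (-1) (by lia)).hom.app X)) ≫ 𝟙 X = 0
    simp)
  exact ⟨r, hr.symm⟩

lemma distTriang_of_iso (hT : Triangle.mk f g h ∈ distTriang C) {X' Y' Z' : C} {f' : X' ⟶ Y'}
    {g' : Y' ⟶ Z'} {h' : Z' ⟶ X'⟦(1 : ℤ)⟧} (eX : X ≅ X') (eY : Y ≅ Y') (eZ : Z ≅ Z')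
    (hf : f ≫ eY.hom = eX.hom ≫ f') (hg : g ≫ eZ.hom = eY.hom ≫ g')
    (hh : h ≫ eX.hom⟦(1 : ℤ)⟧' = eZ.hom ≫ h') : Triangle.mk f' g' h' ∈ distTriang C :=
  isomorphic_distinguished _ hT _ (Triangle.isoMk _ _ eX eY eZ hf hg hh).symm

lemma exists_iso_fibre (hT : Triangle.mk f g h ∈ distTriang C) {X' Y' Z' : C} {f' : X' ⟶ Y'}
    {g' : Y' ⟶ Z'} {h' : Z' ⟶ X'⟦(1 : ℤ)⟧} (hT' : Triangle.mk f' g' h' ∈ distTriang C)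
    (eY : Y ≅ Y') (eZ : Z ≅ Z') (hg : g ≫ eZ.hom = eY.hom ≫ g') : Nonempty (X ≅ X') := by
  obtain ⟨e, -⟩ := exists_iso_of_arrow_iso _ _ (rot_of_distTriang _ hT) (rot_of_distTriang _ hT')
    (Arrow.isoMk eY eZ hg.symm)
  have e₃ : X⟦(1 : ℤ)⟧ ≅ X'⟦(1 : ℤ)⟧ := Triangle.π₃.mapIso e
  exact ⟨(shiftFunctor C (1 : ℤ)).preimageIso e₃⟩

lemma exists_map_distTriang {D : Type*} [Category* D] [Preadditive D] [HasZeroObject D]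
    [HasShift D ℤ] [∀ n : ℤ, (shiftFunctor D n).Additive] [Pretriangulated D] (F : C ⥤ D)
    [F.CommShift ℤ] [F.IsTriangulated] (hT : Triangle.mk f g h ∈ distTriang C) :
    ∃ h', Triangle.mk (F.map f) (F.map g) h' ∈ distTriang D :=
  ⟨_, F.map_distinguished _ hT⟩

end Triangles

/-! ### Mapping telescopes -/

section Telescope

variable {C : Type*} [Category* C] [Preadditive C]
  {X : ℕ → C} (x : ∀ n, X n ⟶ X (n + 1)) [HasCoproduct X]

/-- The endomorphism `1 - shift` of the coproduct of a sequence, whose cone is the mapping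
telescope of the sequence. -/
noncomputable def telescopeMap : ∐ X ⟶ ∐ X :=
  Sigma.desc fun n => Sigma.ι X n - x n ≫ Sigma.ι X (n + 1)

lemma ι_telescopeMap (n : ℕ) :
    Sigma.ι X n ≫ telescopeMap x = Sigma.ι X n - x n ≫ Sigma.ι X (n + 1) := by
  simp [telescopeMap]

variable [HasZeroObject C] [HasShift C ℤ] [∀ n : ℤ, (shiftFunctor C n).Additive]
  [Pretriangulated C]

/-- The telescope is only a weak colimit: compatible maps extend to it, without uniqueness.
Existence is all that the truncation argument needs. -/
lemma exists_desc_of_telescope {K : C} {q : ∐ X ⟶ K} {δ : K ⟶ (∐ X)⟦(1 : ℤ)⟧}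
    (hT : Triangle.mk (telescopeMap x) q δ ∈ distTriang C) {Z : C} (f : ∀ n, X n ⟶ Z)
    (hf : ∀ n, x n ≫ f (n + 1) = f n) :
    ∃ g : K ⟶ Z, ∀ n, Sigma.ι X n ≫ q ≫ g = f n := by
  have h0 : telescopeMap x ≫ Sigma.desc f = 0 := by
    refine Sigma.hom_ext _ _ fun n => ?_
    rw [← Category.assoc, ι_telescopeMap, Preadditive.sub_comp, Category.assoc, Sigma.ι_desc,
      Sigma.ι_desc, hf, sub_self, comp_zero]
  obtain ⟨g, hg⟩ := exists_factor_mor₂ hT (Sigma.desc f) h0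
  exact ⟨g, fun n => by rw [← hg, Sigma.ι_desc]⟩

variable {D : Type*} [Category* D] [Preadditive D] [HasZeroObject D] [HasShift D ℤ]
  [∀ n : ℤ, (shiftFunctor D n).Additive] [Pretriangulated D]

/-- If the maps of a sequence `Y` factor through a fixed object `W` compatibly, then `W` is its
mapping telescope. -/
lemma exists_iso_telescope (F : C ⥤ D) [F.CommShift ℤ] [F.IsTriangulated]
    [PreservesColimit (Discrete.functor X) F]
    {K : C} {q : ∐ X ⟶ K} {δ : K ⟶ (∐ X)⟦(1 : ℤ)⟧}
    (hT : Triangle.mk (telescopeMap x) q δ ∈ distTriang C)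
    {W : D} (a : ∀ n, F.obj (X n) ⟶ W) (b : ∀ n, W ⟶ F.obj (X (n + 1)))
    (hab : ∀ n, a n ≫ b n = F.map (x n)) (hba : ∀ n, b n ≫ a (n + 1) = 𝟙 W) :
    ∃ e : F.obj K ≅ W, ∀ n, F.map (Sigma.ι X n ≫ q) ≫ e.hom = a n := by
  have hc := isColimitCofanMkObjOfIsColimit F X (fun n => Sigma.ι X n) (coproductIsCoproduct X)
  have hext : ∀ {Z : D} (f g : F.obj (∐ X) ⟶ Z),
      (∀ n, F.map (Sigma.ι X n) ≫ f = F.map (Sigma.ι X n) ≫ g) → f = g := fun f g h =>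
    Cofan.IsColimit.hom_ext hc _ _ h
  have hdesc : ∀ {Z : D} (f : ∀ n, F.obj (X n) ⟶ Z),
      ∃ g : F.obj (∐ X) ⟶ Z, ∀ n, F.map (Sigma.ι X n) ≫ g = f n := fun f =>
    ⟨Cofan.IsColimit.desc hc f, fun n => Cofan.IsColimit.fac hc f n⟩
  have hs : ∀ n, F.map (Sigma.ι X n) ≫ F.map (telescopeMap x) =
      F.map (Sigma.ι X n) - F.map (x n) ≫ F.map (Sigma.ι X (n + 1)) := fun n => by
    rw [← F.map_comp, ι_telescopeMap, F.map_sub, F.map_comp]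
  set S := F.map (telescopeMap x)
  set i := fun n => F.map (Sigma.ι X n) with hi
  obtain ⟨A, hA⟩ := hdesc a
  -- `1 - shift` is a split monomorphism. These partial sums correct the inclusions to a retraction
  -- `r`, and the complementary idempotent `1 - r ≫ S` is `A ≫ b 0 ≫ i 1`, which splits through `W`.
  -- Hence the cone of `S` is `W`.
  let c : ∀ n, W ⟶ F.obj (∐ X) := fun n => ∑ j ∈ Finset.range n, b j ≫ i (j + 1)
  have hc1 : ∀ n, c (n + 1) = c n + b n ≫ i (n + 1) := fun n => Finset.sum_range_succ _ _
  obtain ⟨r, hr⟩ := hdesc fun n => i n - a n ≫ c n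
  have hSr : S ≫ r = 𝟙 _ := by
    refine hext _ _ fun n => ?_
    rw [← Category.assoc, hs, Preadditive.sub_comp, Category.assoc, hr, hr, hc1]
    simp only [Preadditive.comp_sub, Preadditive.comp_add, ← hab, Category.assoc, reassoc_of% hba,
      Category.comp_id]
    abel
  have hcS : ∀ n, c n ≫ S = b 0 ≫ i 1 - b n ≫ i (n + 1) := fun n => by
    induction n with
    | zero => simp [c]
    | succ n ih =>
      rw [hc1, Preadditive.add_comp, ih, Category.assoc, hs]
      simp only [Preadditive.comp_sub, ← hab, Category.assoc, reassoc_of% hba, hi]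
      abel
  have hrS : r ≫ S + A ≫ b 0 ≫ i 1 = 𝟙 _ := by
    refine hext _ _ fun n => ?_
    rw [Preadditive.comp_add, reassoc_of% (hr n), reassoc_of% (hA n), Preadditive.sub_comp,
      Category.assoc, hcS, hs, Category.comp_id]
    simp only [Preadditive.comp_sub, ← hab, Category.assoc, hi]
    abel
  obtain ⟨δ', hT'⟩ := exists_map_distTriang F hT
  have hmono : Mono S := mono_of_mono_fac hSr
  have hepi : Epi (F.map q) := (epi_mor₂_iff hT').2 hmono
  have hSA : S ≫ A = 0 := by
    refine hext _ _ fun n => ?_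
    rw [← Category.assoc, hs, Preadditive.sub_comp, Category.assoc, hA, hA, ← hab, Category.assoc,
      hba]
    simp
  obtain ⟨e, he⟩ : ∃ e : F.obj K ⟶ W, A = F.map q ≫ e := exists_factor_mor₂ hT' A hSA
  have hSq : S ≫ F.map q = 0 := comp_eq_zero_of_distTriang hT'
  refine ⟨⟨e, b 0 ≫ i 1 ≫ F.map q, ?_, ?_⟩, fun n => ?_⟩
  · rw [← cancel_epi (F.map q), ← reassoc_of% he, Category.comp_id]
    calc A ≫ b 0 ≫ i 1 ≫ F.map q = (A ≫ b 0 ≫ i 1) ≫ F.map q := by simp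
      _ = (𝟙 _ - r ≫ S) ≫ F.map q := by rw [← hrS]; simp
      _ = F.map q := by simp [hSq]
  · rw [Category.assoc, Category.assoc, ← he, hA, hba]
  · rw [F.map_comp, Category.assoc, ← he, hA]

end Telescope

/-! ### t-structures induced along a conservative exact functor -/

section Induced

variable {C : Type*} [Category* C] [Preadditive C] [HasZeroObject C] [HasShift C ℤ]
  [∀ n : ℤ, (shiftFunctor C n).Additive] [Pretriangulated C]
  {D : Type*} [Category* D] [Preadditive D] [HasZeroObject D] [HasShift D ℤ]
  [∀ n : ℤ, (shiftFunctor D n).Additive] [Pretriangulated D]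

/-- A morphism `X ⟶ W` is a truncation if `W ≥ 1` and its fibre is `≤ 0`. -/
def IsTruncation (t : TStructure D) {X W : D} (a : X ⟶ W) : Prop :=
  t.ge 1 W ∧ ∃ (A : D) (f : A ⟶ X) (h : W ⟶ A⟦(1 : ℤ)⟧), t.le 0 A ∧
    Triangle.mk f a h ∈ distTriang D

lemma IsTruncation.of_iso {t : TStructure D} {X W W' : D} {a : X ⟶ W} (ha : IsTruncation t a)
    (e : W ≅ W') {a' : X ⟶ W'} (h : a ≫ e.hom = a') : IsTruncation t a' := by
  obtain ⟨hW, A, f, δ, hA, hT⟩ := ha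
  refine ⟨(t.ge 1).prop_of_iso e hW, A, f, e.inv ≫ δ, hA, ?_⟩
  exact distTriang_of_iso hT (Iso.refl _) (Iso.refl _) e (by simp) (by simp [h]) (by simp)

/-- The map `a` is zero by orthogonality, so the identity of `W` factors through `A⟦1⟧`. As `A⟦1⟧ ≤
-1` and `W ≥ 1`, it vanishes. -/
lemma IsTruncation.isZero {t : TStructure D} {X W : D} {a : X ⟶ W} (ha : IsTruncation t a)
    (hX : t.le 0 X) : IsZero W := by
  obtain ⟨hW, A, f, δ, hA, hT⟩ := ha
  rw [IsZero.iff_id_eq_zero]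
  obtain ⟨g, hg⟩ := exists_factor_mor₃ hT (𝟙 W) (t.zero' _ hX hW)
  have : t.IsLE (A⟦(1 : ℤ)⟧) (-1) := ⟨t.le_shift 0 1 (-1) (by lia) _ hA⟩
  have : t.IsGE W 1 := ⟨hW⟩
  rw [hg, t.zero g (-1) 1 (by lia), comp_zero]

variable {Φ : C ⥤ D} {L : D ⥤ C} (adj : L ⊣ Φ) [Φ.CommShift ℤ] [Φ.IsTriangulated]
  (t : TStructure D)

include adj in
/-- The step in the construction of truncations: kill the part `≤ 0` of `Φ X`. -/
lemma exists_truncation_step (hL : ∀ Y, t.le 0 Y → t.le 0 (Φ.obj (L.obj Y)))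
    {X : C} {W : D} (a : Φ.obj X ⟶ W) (ha : IsTruncation t a) :
    ∃ (X' : C) (a' : Φ.obj X' ⟶ W) (x : X ⟶ X') (b : W ⟶ Φ.obj X'), IsTruncation t a' ∧
      a ≫ b = Φ.map x ∧ b ≫ a' = 𝟙 W ∧
      ∀ Z : C, t.ge 1 (Φ.obj Z) → ∀ f : X ⟶ Z, ∃ f' : X' ⟶ Z, x ≫ f' = f := by
  obtain ⟨hW, A, f, δ, hA, hT⟩ := ha
  have hWi : t.IsGE W 1 := ⟨hW⟩
  have hA1 : t.IsLE (A⟦(1 : ℤ)⟧) (-1) := ⟨t.le_shift 0 1 (-1) (by lia) _ hA⟩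
  let g : L.obj A ⟶ X := (adj.homEquiv _ _).symm f
  have hg : f = adj.unit.app A ≫ Φ.map g := by
    exact ((adj.homEquiv _ _).apply_symm_apply f).symm.trans (adj.homEquiv_unit _ _ _)
  obtain ⟨X', x, ε, hT'⟩ := distinguished_cocone_triangle g
  obtain ⟨δΦ, hΦT⟩ := exists_map_distTriang Φ hT'
  have hgx : Φ.map g ≫ Φ.map x = 0 := comp_eq_zero_of_distTriang hΦT
  -- `f` factors through `Φ.map g`, so `Φ.map x` kills `A` and descends to `W`. Conversely `a` kills
  -- `Φ (L A) ≤ 0` and descends to `Φ X'`. Thus `W` is a direct summand of `Φ X'`.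
  obtain ⟨b, hb⟩ : ∃ b : W ⟶ Φ.obj X', Φ.map x = a ≫ b :=
    exists_factor_mor₂ hT (Φ.map x) (by rw [hg, Category.assoc, hgx, comp_zero])
  obtain ⟨a', ha'⟩ : ∃ a' : Φ.obj X' ⟶ W, a = Φ.map x ≫ a' :=
    exists_factor_mor₂ hΦT a (t.zero' _ (hL A hA) hW)
  have hba : b ≫ a' = 𝟙 W := by
    rw [← sub_eq_zero]
    obtain ⟨k, hk⟩ : ∃ k, b ≫ a' - 𝟙 W = δ ≫ k := exists_factor_mor₃ hT (b ≫ a' - 𝟙 W) (by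
      rw [Preadditive.comp_sub, ← reassoc_of% hb, ← ha', Category.comp_id, sub_self])
    rw [hk, t.zero k (-1) 1 (by lia), comp_zero]
  refine ⟨X', a', x, b, ⟨hW, ?_⟩, hb.symm, hba, fun Z hZ φ => ?_⟩
  · obtain ⟨A', f', δ', hT''⟩ := distinguished_cocone_triangle₁ a'
    refine ⟨A', f', δ', ?_, hT''⟩
    -- The fibre of `a'` is `≤ 0` by orthogonality. Since `f'` splits, a map `w` to `Y ≥ 1` extends
    -- to `w'` on `Φ X'`. Restricted along `Φ.map x` it factors through `W` as `v`, and `w' - a' ≫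
    -- v` factors through `(Φ (L A))⟦1⟧ ≤ -1`, so it is zero.
    rw [TStructure.le_iff_isLE, t.isLE_iff_orthogonal 0 1 (by lia)]
    intro Y w hY
    have hepi : Epi a' := epi_of_epi_fac hba
    have hmono : Mono f' := (epi_mor₂_iff hT'').1 hepi
    obtain ⟨r, hr⟩ := exists_retraction hT''
    obtain ⟨w', hw'⟩ : ∃ w' : Φ.obj X' ⟶ Y, f' ≫ w' = w := ⟨r ≫ w, by rw [reassoc_of% hr]⟩
    obtain ⟨v, hv⟩ : ∃ v : W ⟶ Y, Φ.map x ≫ w' = a ≫ v :=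
      exists_factor_mor₂ hT (Φ.map x ≫ w') (by
        rw [hg, Category.assoc, reassoc_of% hgx, zero_comp, comp_zero])
    have hf'a : f' ≫ a' = 0 := comp_eq_zero_of_distTriang hT''
    obtain ⟨k, hk⟩ := exists_factor_mor₃ hΦT (w' - a' ≫ v) (by
      rw [Preadditive.comp_sub, hv, ← reassoc_of% ha', sub_self])
    have hLA : t.IsLE ((Φ.obj (L.obj A))⟦(1 : ℤ)⟧) (-1) :=
      ⟨t.le_shift 0 1 (-1) (by lia) _ (hL A hA)⟩
    have hk0 : k = 0 := t.zero k (-1) 1 (by lia)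
    rw [hk0, comp_zero, sub_eq_zero] at hk
    rw [← hw', hk, reassoc_of% hf'a, zero_comp]
  -- By adjunction, maps `L A ⟶ Z` are maps `A ⟶ Φ Z`, which vanish since `A ≤ 0` and `Φ Z ≥ 1`.
  · have h0 : g ≫ φ = 0 := by
      apply (adj.homEquiv _ _).injective
      exact (t.zero' _ hA hZ).trans (t.zero' _ hA hZ).symm
    obtain ⟨φ', hφ'⟩ := exists_factor_mor₂ hT' φ h0
    exact ⟨φ', hφ'.symm⟩

include adj in
/-- The sequence of objects obtained by iterating the step. -/
lemma exists_truncation_sequence (hL : ∀ Y, t.le 0 Y → t.le 0 (Φ.obj (L.obj Y))) (X₀ : C) :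
    ∃ (W : D) (X : ℕ → C) (x : ∀ n, X n ⟶ X (n + 1)) (a : ∀ n, Φ.obj (X n) ⟶ W)
      (b : ∀ n, W ⟶ Φ.obj (X (n + 1))) (_ : X₀ ≅ X 0), IsTruncation t (a 0) ∧
      (∀ n, a n ≫ b n = Φ.map (x n)) ∧ (∀ n, b n ≫ a (n + 1) = 𝟙 W) ∧
      ∀ Z : C, t.ge 1 (Φ.obj Z) → ∀ (n : ℕ) (f : X n ⟶ Z), ∃ f' : X (n + 1) ⟶ Z, x n ≫ f' = f := by
  obtain ⟨A, W, hA, hW, f, a₀, δ, hT⟩ := t.exists_triangle (Φ.obj X₀) 0 1 (by lia)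
  -- `W` is fixed once and for all: every stage of the iteration has the same truncation.
  let St := {p : Σ X : C, (Φ.obj X ⟶ W) // IsTruncation t p.2}
  have step : ∀ p : St, ∃ (p' : St) (x : p.1.1 ⟶ p'.1.1) (b : W ⟶ Φ.obj p'.1.1),
      p.1.2 ≫ b = Φ.map x ∧ b ≫ p'.1.2 = 𝟙 W ∧
      ∀ Z : C, t.ge 1 (Φ.obj Z) → ∀ f : p.1.1 ⟶ Z, ∃ f' : p'.1.1 ⟶ Z, x ≫ f' = f := by
    rintro ⟨⟨X, a⟩, ha⟩
    obtain ⟨X', a', x, b, ha', h⟩ := exists_truncation_step adj t hL a ha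
    exact ⟨⟨⟨X', a'⟩, ha'⟩, x, b, h⟩
  choose nxt x b h₁ h₂ h₃ using step
  let p : ℕ → St := fun n => Nat.rec ⟨⟨X₀, a₀⟩, hW, A, f, δ, hA, hT⟩ (fun _ q => nxt q) n
  exact ⟨W, fun n => (p n).1.1, fun n => x (p n), fun n => (p n).1.2, fun n => b (p n),
    Iso.refl _, (p 0).2, fun n => h₁ (p n), fun n => h₂ (p n), fun Z hZ n => h₃ (p n) Z hZ⟩

include adj in
/-- Every object has a truncation with respect to the t-structure induced by `Φ`. -/
lemma exists_truncation (hL : ∀ Y, t.le 0 Y → t.le 0 (Φ.obj (L.obj Y)))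
    (E : CocompleteExtension.{v', u'} Φ) (X : C) :
    ∃ (B : C) (p : X ⟶ B), IsTruncation t (Φ.map p) ∧
      ∀ Z : C, t.ge 1 (Φ.obj Z) → ∀ f : X ⟶ Z, ∃ f' : B ⟶ Z, p ≫ f' = f := by
  obtain ⟨W, X, x, a, b, e₀, ha, hab, hba, hx⟩ := exists_truncation_sequence adj t hL X
  obtain ⟨C', D', ιC, ιD, Φ', hΦ', L', adj', iso, -, hmem⟩ := E
  have : HasCoproductsOfShape ℕ C' :=
    hasColimitsOfShape_of_equivalence (Discrete.equivalence (Equiv.ulift.{v'} (α := ℕ)))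
  have : PreservesColimitsOfShape (Discrete ℕ) Φ' :=
    have := hΦ' (ULift.{v'} ℕ)
    preservesColimitsOfShape_of_equiv (Discrete.equivalence (Equiv.ulift.{v'} (α := ℕ))) Φ'
  obtain ⟨K, q, δ, hT⟩ := distinguished_cocone_triangle (telescopeMap fun n => ιC.map (x n))
  obtain ⟨e, he⟩ := exists_iso_telescope (fun n => ιC.map (x n)) Φ' hT
    (fun n => iso.hom.app (X n) ≫ ιD.map (a n)) (fun n => ιD.map (b n) ≫ iso.inv.app (X (n + 1)))
    (fun n => by
      have := iso.hom.naturality (x n)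
      dsimp at this
      rw [Category.assoc, ← ιD.map_comp_assoc, hab, ← reassoc_of% this]
      simp)
    (fun n => by
      rw [Category.assoc, Iso.inv_hom_id_app_assoc, ← ιD.map_comp, hba, ιD.map_id])
  -- The telescope `K` is built in the large category, but its image is `W`, so it belongs to `C`.
  obtain ⟨B, ⟨k⟩⟩ := hmem K ⟨W, ⟨e.symm⟩⟩
  let p : X 0 ⟶ B := ιC.preimage (Sigma.ι (fun n => ιC.obj (X n)) 0 ≫ q ≫ k.inv)
  have hp : ιC.map p = Sigma.ι (fun n => ιC.obj (X n)) 0 ≫ q ≫ k.inv := ιC.map_preimage _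
  let θ : W ≅ Φ.obj B := ιD.preimageIso (e.symm ≪≫ Φ'.mapIso k.symm ≪≫ iso.app B)
  refine ⟨B, e₀.hom ≫ p, ?_, fun Z hZ f => ?_⟩
  · have hθ : a 0 ≫ θ.hom = Φ.map p := by
      apply ιD.map_injective
      have h1 := he 0
      have h2 := iso.hom.naturality p
      dsimp at h1 h2
      rw [← cancel_epi (iso.hom.app (X 0)), ← h2, hp, ιD.map_comp, ← reassoc_of% h1]
      simp [θ]
    obtain ⟨hW, A, f, δ', hA, hT'⟩ := ha.of_iso θ hθ
    refine ⟨hW, A, f ≫ Φ.map e₀.inv, δ', hA, distTriang_of_iso hT' (Iso.refl _) (Φ.mapIso e₀.symm)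
      (Iso.refl _) (by simp) (by simp) (by simp)⟩
  · choose ext hext using hx Z hZ
    -- The map `f` is extended one stage at a time, and the compatible family then descends to the
    -- telescope.
    let φ : ∀ n, X n ⟶ Z := fun n => Nat.rec (e₀.inv ≫ f) (fun n g => ext n g) n
    obtain ⟨g, hg⟩ := exists_desc_of_telescope (fun n => ιC.map (x n)) hT
      (fun n => ιC.map (φ n)) (fun n => by rw [← ιC.map_comp]; exact congrArg _ (hext n (φ n)))
    refine ⟨ιC.preimage (k.hom ≫ g), ιC.map_injective ?_⟩
    rw [ιC.map_comp, ιC.map_preimage, ιC.map_comp, hp]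
    simp only [Category.assoc, Iso.inv_hom_id_assoc, hg 0]
    rw [← ιC.map_comp]
    exact congrArg _ (e₀.hom_inv_id_assoc f)

/-- A conservative exact functor `Φ` with a left adjoint `L`, such that `L ⋙ Φ` is right t-exact,
induces a t-structure as soon as it extends to cocomplete categories. -/
theorem exists_induced_tStructure (hL : ∀ Y, t.le 0 Y → t.le 0 (Φ.obj (L.obj Y)))
    (hΦ : ∀ X, IsZero (Φ.obj X) → IsZero X) (E : CocompleteExtension.{v', u'} Φ) (adj : L ⊣ Φ) :
    ∃ t' : TStructure C, ∀ (n : ℤ) (X : C),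
      (t'.le n X ↔ t.le n (Φ.obj X)) ∧ (t'.ge n X ↔ t.ge n (Φ.obj X)) := by
  have htr := exists_truncation adj t hL E
  exact ⟨{
    le n := (t.le n).inverseImage Φ
    ge n := (t.ge n).inverseImage Φ
    le_shift n a n' h X hX :=
      (t.le n').prop_of_iso ((Φ.commShiftIso a).app X).symm (t.le_shift n a n' h _ hX)
    ge_shift n a n' h X hX :=
      (t.ge n').prop_of_iso ((Φ.commShiftIso a).app X).symm (t.ge_shift n a n' h _ hX)
    zero' X Y f hX hY := by
      -- If `Φ X ≤ 0`, the truncation `Φ B` is zero, hence `B` is zero by conservativity, and every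
      -- map from `X` to an object `≥ 1` factors through `B`.
      obtain ⟨B, p, hp, hf⟩ := htr X
      obtain ⟨f', rfl⟩ := hf Y hY f
      rw [(hΦ B (hp.isZero hX)).eq_of_src f' 0, comp_zero]
    le_zero_le X hX := t.le_zero_le _ hX
    ge_one_le X hX := t.ge_one_le _ hX
    exists_triangle_zero_one X := by
      obtain ⟨B, p, ⟨hB, A', f', h', hA', hT'⟩, -⟩ := htr X
      obtain ⟨A, f, h, hT⟩ := distinguished_cocone_triangle₁ p
      refine ⟨A, B, ?_, hB, f, p, h, hT⟩
      obtain ⟨_, hFT⟩ := exists_map_distTriang Φ hT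
      obtain ⟨e⟩ := exists_iso_fibre hT' hFT (Iso.refl _) (Iso.refl _) (by simp)
      exact (t.le 0).prop_of_iso e hA' },
    fun n X => ⟨Iff.rfl, Iff.rfl⟩⟩

/-- Pullback of a t-structure along an exact equivalence. -/
theorem exists_tStructure_of_equivalence (U : C ⥤ D) [U.CommShift ℤ] [U.IsTriangulated]
    [U.IsEquivalence] :
    ∃ t' : TStructure C, ∀ (n : ℤ) (X : C),
      (t'.le n X ↔ t.le n (U.obj X)) ∧ (t'.ge n X ↔ t.ge n (U.obj X)) := by
  exact ⟨{
    le n := (t.le n).inverseImage U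
    ge n := (t.ge n).inverseImage U
    le_shift n a n' h X hX :=
      (t.le n').prop_of_iso ((U.commShiftIso a).app X).symm (t.le_shift n a n' h _ hX)
    ge_shift n a n' h X hX :=
      (t.ge n').prop_of_iso ((U.commShiftIso a).app X).symm (t.ge_shift n a n' h _ hX)
    zero' X Y f hX hY := U.map_injective (by rw [t.zero' (U.map f) hX hY, U.map_zero])
    le_zero_le X hX := t.le_zero_le _ hX
    ge_one_le X hX := t.ge_one_le _ hX
    exists_triangle_zero_one X := by
      obtain ⟨A', B', hA', hB', f', g', h', hT'⟩ := t.exists_triangle (U.obj X) 0 1 (by lia)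
      let eB := U.objObjPreimageIso B'
      obtain ⟨A, f, h, hT⟩ := distinguished_cocone_triangle₁ (U.preimage (g' ≫ eB.inv))
      refine ⟨A, U.objPreimage B', ?_, (t.ge 1).prop_of_iso eB.symm hB', f, _, h, hT⟩
      obtain ⟨_, hFT⟩ := exists_map_distTriang U hT
      obtain ⟨e⟩ := exists_iso_fibre hT' hFT (Iso.refl _) eB.symm (by simp)
      exact (t.le 0).prop_of_iso e hA' },
    fun n X => ⟨Iff.rfl, Iff.rfl⟩⟩

end Induced

/-! ### Closure properties of t-structures -/

section Closure

variable {C : Type*} [Category* C] [Preadditive C] [HasZeroObject C] [HasShift C ℤ]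
  [∀ n : ℤ, (shiftFunctor C n).Additive] [Pretriangulated C] (t : TStructure C)

/-- Being `≤ n` is a left orthogonality condition, so it can be tested after writing the identity as
a sum of maps through the `Y j`. This covers finite direct sums and retracts together. -/
lemma le_of_sum_eq_id {J : Type} [Fintype J] {n : ℤ} {X : C} {Y : J → C} (p : ∀ j, X ⟶ Y j)
    (i : ∀ j, Y j ⟶ X) (h : ∑ j, p j ≫ i j = 𝟙 X) (hY : ∀ j, t.le n (Y j)) : t.le n X := by
  rw [TStructure.le_iff_isLE, t.isLE_iff_orthogonal n (n + 1) rfl]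
  intro Z f hZ
  have h0 : ∀ j, i j ≫ f = 0 := fun j =>
    have : t.IsLE (Y j) n := ⟨hY j⟩
    t.zero _ n (n + 1) (by lia)
  rw [← Category.id_comp f, ← h, Preadditive.sum_comp]
  exact Finset.sum_eq_zero fun j _ => by rw [Category.assoc, h0, comp_zero]

variable {t}

lemma le_of_retract {n : ℤ} {X Y : C} (r : Retract X Y) (hY : t.le n Y) : t.le n X :=
  le_of_sum_eq_id t (J := Unit) (fun _ => r.i) (fun _ => r.r) (by simp) fun _ => hY

lemma ge_of_retract {n : ℤ} {X Y : C} (r : Retract X Y) (hY : t.ge n Y) : t.ge n X := by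
  rw [TStructure.ge_iff_isGE, t.isGE_iff_orthogonal (n - 1) n (by lia)]
  intro Z f hZ
  have : t.IsGE Y n := ⟨hY⟩
  have h0 : f ≫ r.i = 0 := t.zero _ (n - 1) n (by lia)
  rw [← Category.comp_id f, ← r.retract, reassoc_of% h0, zero_comp]

end Closure

/-- If a left adjoint is a retract of another one, so is its right adjoint. -/
def retractRightAdjoint {C D : Type*} [Category* C] [Category* D] {F F' : D ⥤ C} {G G' : C ⥤ D}
    (adj : F ⊣ G) (adj' : F' ⊣ G') (r : Retract F F') : Retract G G' where
  i := conjugateEquiv adj adj' r.r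
  r := conjugateEquiv adj' adj r.i
  retract := conjugateEquiv_comm adj adj' r.retract

/-! ### Finite direct sums of functors -/

section DirectSum

variable {C D : Type*} [Category* C] [Category* D] [Preadditive C] [Preadditive D] {J : Type}
  [Fintype J] (F : J → D ⥤ C) (S : D ⥤ C)

/-- The functor `S` is the direct sum of the functors `F j`. -/
structure IsDirectSum where
  /-- the inclusions of the summands -/
  ι : ∀ j, F j ⟶ S
  /-- the projections to the summands -/
  π : ∀ j, S ⟶ F j
  ι_π_self : ∀ j X, (ι j).app X ≫ (π j).app X = 𝟙 _
  ι_π_of_ne : ∀ j k X, j ≠ k → (ι j).app X ≫ (π k).app X = 0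
  sum_π_ι : ∀ X, ∑ j, (π j).app X ≫ (ι j).app X = 𝟙 _

variable {F S}

/-- A map out of `S X` is a family of maps `F j X ⟶ Y`, that is, a family of maps `X ⟶ G j Y`, that
is, one map into their biproduct. -/
lemma IsDirectSum.exists_rightAdjoint [HasFiniteBiproducts D] (s : IsDirectSum F S) {G : J → C ⥤ D}
    (adj : ∀ j, F j ⊣ G j) :
    ∃ T : C ⥤ D, Nonempty (S ⊣ T) ∧ ∀ Y, Nonempty (T.obj Y ≅ ⨁ fun j => (G j).obj Y) := by
  let e : ∀ X Y, (S.obj X ⟶ Y) ≃ (X ⟶ ⨁ fun j => (G j).obj Y) := fun X Y =>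
    { toFun := fun f => biproduct.lift fun j => (adj j).homEquiv _ _ ((s.ι j).app X ≫ f)
      invFun := fun g =>
        ∑ j, (s.π j).app X ≫ ((adj j).homEquiv _ _).symm (g ≫ biproduct.π _ j)
      left_inv := fun f => by
        simp only [biproduct.lift_π, Equiv.symm_apply_apply, ← Category.assoc]
        rw [← Preadditive.sum_comp, s.sum_π_ι, Category.id_comp]
      right_inv := fun g => by
        refine biproduct.hom_ext _ _ fun k => ?_
        rw [biproduct.lift_π, Preadditive.comp_sum, Finset.sum_eq_single k]
        · rw [← Category.assoc, s.ι_π_self, Category.id_comp, Equiv.apply_symm_apply]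
        · intro j _ hj
          rw [← Category.assoc, s.ι_π_of_ne k j X hj.symm, zero_comp]
        · exact fun h => absurd (Finset.mem_univ k) h }
  have he : ∀ X' X Y f g, e X' Y (S.map f ≫ g) = f ≫ e X Y g := fun X' X Y f g => by
    refine biproduct.hom_ext _ _ fun j => ?_
    simp only [e, Equiv.coe_fn_mk, biproduct.lift_π, Category.assoc]
    rw [← (adj j).homEquiv_naturality_left, (s.ι j).naturality_assoc]
  exact ⟨_, ⟨Adjunction.adjunctionOfEquivRight e he⟩, fun Y => ⟨Iso.refl _⟩⟩

end DirectSum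

/-! ### The t-structure induced by a direct sum of left adjoints -/

section Induced

variable {C : Type*} [Category* C] [Preadditive C] [HasZeroObject C] [HasShift C ℤ]
  [∀ n : ℤ, (shiftFunctor C n).Additive] [Pretriangulated C]
  {D : Type*} [Category* D] [Preadditive D] [HasZeroObject D] [HasShift D ℤ]
  [∀ n : ℤ, (shiftFunctor D n).Additive] [Pretriangulated D]

/-- The t-structure induced by the right adjoint of a direct sum of exact functors. -/
theorem exists_tStructure_of_isDirectSum {J : Type} [Fintype J] {F : J → D ⥤ C} {S : D ⥤ C}
    [∀ j, (F j).Additive] [S.CommShift ℤ] [S.IsTriangulated] (s : IsDirectSum F S) (t : TStructure D)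
    (hF : ∀ j, (F j).IsLeftAdjoint) (hgen : WeaklyGenerates fun X => S.obj X)
    (hexact : ∀ (l m : J) (G : C ⥤ D), Nonempty (F l ⊣ G) → IsTExact t t (F m ⋙ G))
    (hext : ∀ G : C ⥤ D, Nonempty (S ⊣ G) → Nonempty (CocompleteExtension.{v', u'} G)) :
    ∃ t' : TStructure C, ∀ G : C ⥤ D, Nonempty (S ⊣ G) → ∀ (n : ℤ) (X : C),
      (t'.le n X ↔ t.le n (G.obj X)) ∧ (t'.ge n X ↔ t.ge n (G.obj X)) := by
  let adj j := Adjunction.ofIsLeftAdjoint (F j)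
  obtain ⟨T, ⟨adjT⟩, hT⟩ := s.exists_rightAdjoint adj
  obtain ⟨E⟩ := hext T ⟨adjT⟩
  let := adjT.rightAdjointCommShift ℤ
  have := adjT.commShift_of_leftAdjoint ℤ
  have := adjT.isTriangulated_rightAdjoint
  obtain ⟨t', ht'⟩ := exists_induced_tStructure t (Φ := T) (L := S) (fun X hX => by
    obtain ⟨e⟩ := hT (S.obj X)
    -- The object `T (S X)` is decomposed twice, first over the right adjoints and then over the
    -- summands of `S`. The pieces are the values of the t-exact functors `(F j)^R (F m)`.
    refine (t.le 0).prop_of_iso e.symm (le_of_sum_eq_id t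
      (biproduct.π fun j => ((F j).rightAdjoint).obj (S.obj X)) (biproduct.ι _)
      biproduct.total fun j => ?_)
    have hadd : ((F j).rightAdjoint).Additive := (adj j).right_adjoint_additive
    refine le_of_sum_eq_id t (fun m => ((F j).rightAdjoint).map ((s.π m).app X))
      (fun m => ((F j).rightAdjoint).map ((s.ι m).app X)) ?_ fun m => ?_
    · simp only [← Functor.map_comp]
      rw [← Functor.map_sum, s.sum_π_ι, CategoryTheory.Functor.map_id]
    · exact (hexact j m _ ⟨adj j⟩).1 X hX)
    (fun Y hY => hgen Y fun X n f => by
      rw [← cancel_epi ((S.commShiftIso n).hom.app X), comp_zero]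
      exact (adjT.homEquiv _ _).injective (hY.eq_of_tgt _ _)) E adjT
  refine ⟨t', fun G ⟨adjG⟩ n X => ?_⟩
  let e : T.obj X ≅ G.obj X := (adjT.rightAdjointUniq adjG).app X
  exact ⟨(ht' n X).1.trans ((t.le n).prop_iff_of_iso e),
    (ht' n X).2.trans ((t.ge n).prop_iff_of_iso e)⟩

end Induced

/-! ### The functors attached to 1-morphisms -/

section Realization

variable {B : Type u} [Bicategory.{w, v} B] (R : Pseudofunctor B Cat.{v₁, u₁})

/-- The functors attached to isomorphic 1-morphisms are isomorphic. -/
def mapIso {a b : B} {f g : a ⟶ b} (e : f ≅ g) : (R.map f).toFunctor ≅ (R.map g).toFunctor :=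
  Cat.Hom.toNatIso ((R.mapFunctor a b).mapIso e)

/-- The functor attached to a composite of 1-morphisms. -/
def mapCompIso {a b c : B} (f : a ⟶ b) (g : b ⟶ c) :
    (R.map (f ≫ g)).toFunctor ≅ (R.map f).toFunctor ⋙ (R.map g).toFunctor :=
  Cat.Hom.toNatIso (R.mapComp f g)

/-- The functor attached to an identity 1-morphism. -/
def mapIdIso (a : B) : (R.map (𝟙 a)).toFunctor ≅ 𝟭 _ :=
  Cat.Hom.toNatIso (R.mapId a)

/-- The functor attached to a retract. -/
def mapRetract {a b : B} {f g : a ⟶ b} (r : Retract f g) :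
    Retract (R.map f).toFunctor (R.map g).toFunctor where
  i := (R.map₂ r.i).toNatTrans
  r := (R.map₂ r.r).toNatTrans
  retract := by
    rw [← Cat.Hom.toNatTrans_comp, ← R.map₂_comp, r.retract, R.map₂_id, Cat.Hom.toNatTrans_id]

/-- The functors attached to two 1-morphisms are adjoint. -/
def MapAdj {a b : B} (f : a ⟶ b) (g : b ⟶ a) : Prop :=
  Nonempty ((R.map f).toFunctor ⊣ (R.map g).toFunctor)

variable {R}

lemma MapAdj.of_adjunction {a b : B} {f : a ⟶ b} {g : b ⟶ a} (adj : Bicategory.Adjunction f g) :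
    MapAdj R f g :=
  ⟨Adjunction.ofCat (R.mapAdjunction adj)⟩

lemma MapAdj.of_iso {a b : B} {f f' : a ⟶ b} {g g' : b ⟶ a} (h : MapAdj R f g)
    (e : Nonempty (f ≅ f')) (e' : Nonempty (g ≅ g')) : MapAdj R f' g' := by
  obtain ⟨h⟩ := h
  obtain ⟨e⟩ := e
  obtain ⟨e'⟩ := e'
  exact ⟨(h.ofNatIsoLeft (mapIso R e)).ofNatIsoRight (mapIso R e')⟩

lemma MapAdj.comp {a b c : B} {f : a ⟶ b} {g : b ⟶ a} {f' : b ⟶ c} {g' : c ⟶ b}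
    (h : MapAdj R f g) (h' : MapAdj R f' g') : MapAdj R (f ≫ f') (g' ≫ g) := by
  obtain ⟨h⟩ := h
  obtain ⟨h'⟩ := h'
  exact ⟨((h.comp h').ofNatIsoLeft (mapCompIso R f f').symm).ofNatIsoRight
    (mapCompIso R g' g).symm⟩

/-- The equivalence attached to an invertible 1-morphism. -/
def mapEquivalence {a b : B} {f : a ⟶ b} {g : b ⟶ a} (e : f ≫ g ≅ 𝟙 a) (e' : g ≫ f ≅ 𝟙 b) :
    R.obj a ≌ R.obj b :=
  CategoryTheory.Equivalence.mk (R.map f).toFunctor (R.map g).toFunctor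
    ((mapIdIso R a).symm ≪≫ mapIso R e.symm ≪≫ mapCompIso R f g)
    ((mapCompIso R g f).symm ≪≫ mapIso R e' ≪≫ mapIdIso R b)

lemma MapAdj.of_inverse {a b : B} {f : a ⟶ b} {g : b ⟶ a} (e : Nonempty (f ≫ g ≅ 𝟙 a))
    (e' : Nonempty (g ≫ f ≅ 𝟙 b)) : MapAdj R f g :=
  ⟨(mapEquivalence e.some e'.some).toAdjunction⟩

/-- If `f ≫ m` is a retract of `g`, then the right adjoints of `f` and `g` are related by the
right adjoint of `m`. -/
lemma MapAdj.nonempty_retract {a b c : B} {m : b ⟶ c} {l : c ⟶ b} (h : MapAdj R m l) {f : a ⟶ b}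
    {g : a ⟶ c} (r : Retract (f ≫ m) g) {G : R.obj b ⥤ R.obj a} {G' : R.obj c ⥤ R.obj a}
    (adj : (R.map f).toFunctor ⊣ G) (adj' : (R.map g).toFunctor ⊣ G') (X : R.obj c) :
    Nonempty (Retract (G.obj ((R.map l).toFunctor.obj X)) (G'.obj X)) := by
  obtain ⟨h⟩ := h
  exact ⟨(retractRightAdjoint ((adj.comp h).ofNatIsoLeft (mapCompIso R f m).symm) adj'
    (mapRetract R r)).map ((evaluation _ _).obj X)⟩

variable [TriangulatedBicategory B] [TriangulatedRealization R]

/-- The value at an object of the functor attached to a shifted 1-morphism. -/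
noncomputable def mapShiftIso {a b : B} (f : a ⟶ b) (n : ℤ) (X : R.obj a) :
    (R.map (f⟦n⟧)).toFunctor.obj X ≅ ((R.map f).toFunctor.obj X)⟦n⟧ :=
  ((evalAt R b X).commShiftIso n).app f

/-- The functor attached to a direct sum of 1-morphisms. -/
noncomputable def isDirectSumMap {a b : B} {J : Type} [Fintype J] (f : J → (a ⟶ b)) :
    IsDirectSum (fun j => (R.map (f j)).toFunctor) (R.map (⨁ f)).toFunctor where
  ι j := (R.map₂ (biproduct.ι f j)).toNatTrans
  π j := (R.map₂ (biproduct.π f j)).toNatTrans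
  ι_π_self j X := by
    have := (evalAt R b X).map_comp (biproduct.ι f j) (biproduct.π f j)
    rw [biproduct.ι_π_self, CategoryTheory.Functor.map_id] at this
    exact this.symm
  ι_π_of_ne j k X h := by
    have := (evalAt R b X).map_comp (biproduct.ι f j) (biproduct.π f k)
    rw [biproduct.ι_π_ne _ h, Functor.map_zero] at this
    exact this.symm
  sum_π_ι X := by
    have := (evalAt R b X).map_sum (fun j => biproduct.π f j ≫ biproduct.ι f j) Finset.univ
    rw [biproduct.total, CategoryTheory.Functor.map_id] at this
    refine Eq.trans (Finset.sum_congr rfl fun j _ => ?_) this.symm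
    exact ((evalAt R b X).map_comp (biproduct.π f j) (biproduct.ι f j)).symm

end Realization

/-! ### Isomorphism classes of 1-morphisms -/

/-- The category with the same objects as a bicategory, and with isomorphism classes of
1-morphisms as morphisms. -/
structure IsoCat (B : Type u) where
  /-- the underlying object -/
  as : B

namespace IsoCat

section Basic

variable {B : Type u} [Bicategory.{w, v} B]

instance : Category (IsoCat B) where
  Hom X Y := Quotient (isIsomorphicSetoid (X.as ⟶ Y.as))
  id X := Quotient.mk _ (𝟙 X.as)
  comp := Quotient.map₂ (· ≫ ·) fun _ _ ⟨e⟩ _ _ ⟨e'⟩ =>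
    ⟨Bicategory.whiskerRightIso e _ ≪≫ Bicategory.whiskerLeftIso _ e'⟩
  id_comp := by
    rintro _ _ ⟨f⟩
    exact Quotient.sound ⟨Bicategory.leftUnitor f⟩
  comp_id := by
    rintro _ _ ⟨f⟩
    exact Quotient.sound ⟨Bicategory.rightUnitor f⟩
  assoc := by
    rintro _ _ _ _ ⟨f⟩ ⟨g⟩ ⟨h⟩
    exact Quotient.sound ⟨Bicategory.associator f g h⟩

/-- The isomorphism class of a 1-morphism. -/
def cl {a b : B} (f : a ⟶ b) : (⟨a⟩ : IsoCat B) ⟶ ⟨b⟩ := Quotient.mk _ f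

lemma cl_eq_iff {a b : B} {f g : a ⟶ b} : cl f = cl g ↔ Nonempty (f ≅ g) := Quotient.eq

lemma cl_comp {a b c : B} (f : a ⟶ b) (g : b ⟶ c) : cl (f ≫ g) = cl f ≫ cl g := rfl

lemma exists_rep {X Y : IsoCat B} (x : X ⟶ Y) : ∃ f : X.as ⟶ Y.as, cl f = x := Quotient.exists_rep x

lemma cl_npow {a : B} {f : a ⟶ a} (p : Aut (⟨a⟩ : IsoCat B)) (hp : p.hom = cl f) (n : ℕ) :
    cl (npow f n) = (p ^ n).hom := by
  induction n with
  | zero => rfl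
  | succ n ih =>
    rw [pow_succ', npow, cl_comp, ih, ← hp]
    rfl

lemma cl_zpow {a : B} {f g : a ⟶ a} (p : Aut (⟨a⟩ : IsoCat B)) (hp : p.hom = cl f)
    (hp' : p.inv = cl g) (n : ℤ) : cl (zpow f g n) = (p ^ n).hom := by
  cases n with
  | ofNat n => exact (cl_npow p hp n).trans (by simp)
  | negSucc n => exact (cl_npow p⁻¹ hp' (n + 1)).trans (by simp [zpow_negSucc])

end Basic

/-! ### Adjunctions between isomorphism classes -/

section Adjunction

variable {B : Type u} [Bicategory.{w, v} B] (R : Pseudofunctor B Cat.{v₁, u₁})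

/-- The functors attached to representatives of `x` and `y` are adjoint. -/
def IsAdj {X Y : IsoCat B} (x : X ⟶ Y) (y : Y ⟶ X) : Prop :=
  ∃ (f : X.as ⟶ Y.as) (g : Y.as ⟶ X.as), cl f = x ∧ cl g = y ∧ MapAdj R f g

variable {R}

lemma isAdj_cl {a b : B} {f : a ⟶ b} {g : b ⟶ a} : IsAdj R (cl f) (cl g) ↔ MapAdj R f g :=
  ⟨fun ⟨_, _, hf, hg, h⟩ => h.of_iso (cl_eq_iff.1 hf) (cl_eq_iff.1 hg),
    fun h => ⟨f, g, rfl, rfl, h⟩⟩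

lemma IsAdj.comp {X Y Z : IsoCat B} {x : X ⟶ Y} {y : Y ⟶ X} {x' : Y ⟶ Z} {y' : Z ⟶ Y}
    (h : IsAdj R x y) (h' : IsAdj R x' y') : IsAdj R (x ≫ x') (y' ≫ y) := by
  obtain ⟨f, g, rfl, rfl, h⟩ := h
  obtain ⟨f', g', rfl, rfl, h'⟩ := h'
  exact ⟨_, _, rfl, rfl, h.comp h'⟩

lemma IsAdj.of_inverse {X Y : IsoCat B} {x : X ⟶ Y} {y : Y ⟶ X} (h : x ≫ y = 𝟙 X)
    (h' : y ≫ x = 𝟙 Y) : IsAdj R x y := by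
  obtain ⟨f, rfl⟩ := exists_rep x
  obtain ⟨g, rfl⟩ := exists_rep y
  exact ⟨f, g, rfl, rfl, MapAdj.of_inverse (cl_eq_iff.1 h) (cl_eq_iff.1 h')⟩

end Adjunction

section Triangulated

open scoped ZeroObject

variable {B : Type u} [Bicategory.{w, v} B] [TriangulatedBicategory B]

/-- The shift on isomorphism classes of 1-morphisms. -/
noncomputable def shift {X Y : IsoCat B} (n : ℤ) : (X ⟶ Y) → (X ⟶ Y) :=
  Quotient.map (fun f : X.as ⟶ Y.as => f⟦n⟧) fun _ _ ⟨e⟩ => ⟨(shiftFunctor _ n).mapIso e⟩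

lemma cl_shift {a b : B} (f : a ⟶ b) (n : ℤ) : cl (f⟦n⟧) = shift n (cl f) := rfl

@[simp]
lemma shift_comp {X Y Z : IsoCat B} (n : ℤ) (x : X ⟶ Y) (y : Y ⟶ Z) :
    shift n x ≫ y = shift n (x ≫ y) := by
  obtain ⟨f, rfl⟩ := exists_rep x
  obtain ⟨g, rfl⟩ := exists_rep y
  exact Quotient.sound ⟨((Bicategory.postcomp X.as g).commShiftIso n).app f⟩

@[simp]
lemma comp_shift {X Y Z : IsoCat B} (n : ℤ) (x : X ⟶ Y) (y : Y ⟶ Z) :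
    x ≫ shift n y = shift n (x ≫ y) := by
  obtain ⟨f, rfl⟩ := exists_rep x
  obtain ⟨g, rfl⟩ := exists_rep y
  exact Quotient.sound ⟨((Bicategory.precomp Z.as f).commShiftIso n).app g⟩

@[simp]
lemma shift_shift {X Y : IsoCat B} (m n : ℤ) (x : X ⟶ Y) :
    shift m (shift n x) = shift (m + n) x := by
  obtain ⟨f, rfl⟩ := exists_rep x
  exact Quotient.sound ⟨((shiftFunctorAdd' (X.as ⟶ Y.as) n m (m + n) (add_comm _ _)).app f).symm⟩

@[simp]
lemma shift_zero {X Y : IsoCat B} (x : X ⟶ Y) : shift 0 x = x := by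
  obtain ⟨f, rfl⟩ := exists_rep x
  exact Quotient.sound ⟨(shiftFunctorZero (X.as ⟶ Y.as) ℤ).app f⟩

lemma shift_eq_iff {X Y : IsoCat B} (n : ℤ) (x y : X ⟶ Y) : shift n x = y ↔ x = shift (-n) y := by
  constructor
  · rintro rfl
    simp
  · rintro rfl
    simp

noncomputable instance (X Y : IsoCat B) : Zero (X ⟶ Y) := ⟨cl (0 : X.as ⟶ Y.as)⟩

lemma cl_eq_zero_iff {a b : B} {f : a ⟶ b} : cl f = 0 ↔ IsZero f :=
  cl_eq_iff.trans
    ⟨fun ⟨e⟩ => (isZero_zero _).of_iso e, fun h => ⟨h.iso (isZero_zero _)⟩⟩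

noncomputable instance : HasZeroMorphisms (IsoCat B) where
  comp_zero := by
    intro X Y x Z
    obtain ⟨f, rfl⟩ := exists_rep x
    exact cl_eq_zero_iff.2 ((Bicategory.precomp Z.as f).map_isZero (isZero_zero _))
  zero_comp := by
    intro X Y Z x
    obtain ⟨f, rfl⟩ := exists_rep x
    exact cl_eq_zero_iff.2 ((Bicategory.postcomp X.as f).map_isZero (isZero_zero _))

/-- If the middle term of an exact triangle is zero, the third is a shift of the first. -/
lemma eq_shift_of_exactTriangle {a b : B} {f g h : a ⟶ b} (hT : ExactTriangle f g h)
    (hg : cl g = 0) : cl f = shift (-1) (cl h) := by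
  obtain ⟨u, w, δ, hT⟩ := hT
  have : IsIso δ := (Triangle.isZero₂_iff_isIso₃ _ hT).1 (cl_eq_zero_iff.1 hg)
  have h1 : cl h = shift 1 (cl f) := cl_eq_iff.2 ⟨asIso δ⟩
  rw [h1, shift_shift]
  simp

/-! ### Crossing invertible 1-morphisms -/

section Crossing

variable {X Y : IsoCat B} {p : ℤ → ℤ → (X ⟶ X)} {q : ℤ → ℤ → (Y ⟶ Y)} {f : ℤ → (X ⟶ Y)} {σ : ℤ}

/-- The relation which moves `q a b` to the other side of `f s`. -/
def Crosses (p : ℤ → ℤ → (X ⟶ X)) (q : ℤ → ℤ → (Y ⟶ Y)) (f : ℤ → (X ⟶ Y)) (σ s a b : ℤ) : Prop :=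
  f s ≫ q a b = shift (σ * (a - b)) (p a b ≫ f (s - a - b))

variable (hp : ∀ a b a' b', p a b ≫ p a' b' = p (a + a') (b + b')) (hp0 : p 0 0 = 𝟙 X)
  (hq : ∀ a b a' b', q a b ≫ q a' b' = q (a + a') (b + b')) (hq0 : q 0 0 = 𝟙 Y)

include hp hq in
lemma Crosses.trans {s a b a' b' : ℤ} (h : Crosses p q f σ s a b)
    (h' : Crosses p q f σ (s - a - b) a' b') : Crosses p q f σ s (a + a') (b + b') := by
  rw [Crosses, ← hq, ← Category.assoc, h, shift_comp, Category.assoc, h', comp_shift, shift_shift,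
    ← Category.assoc, hp]
  congr 1
  · ring
  · congr 2
    ring

include hp hp0 hq hq0 in
-- Multiply the relation by the inverse powers on both sides. The new starting index is the old
-- final one.
lemma Crosses.symm {s a b : ℤ} (h : Crosses p q f σ s a b) :
    Crosses p q f σ (s - a - b) (-a) (-b) := by
  have h1 : f (s - a - b) = shift (-(σ * (a - b))) (p (-a) (-b) ≫ f s ≫ q a b) := by
    rw [h, comp_shift, shift_shift, ← Category.assoc, hp]
    simp [hp0]
  rw [Crosses, h1, shift_comp, Category.assoc, Category.assoc, hq]
  simp only [add_neg_cancel, hq0, Category.comp_id]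
  congr 1
  · ring
  · congr 2
    ring

include hp0 hq0 in
lemma crosses_zero (s : ℤ) : Crosses p q f σ s 0 0 := by
  simp [Crosses, hp0, hq0]

variable {m : ℤ} (hm : 1 ≤ m)
  (h₁ : ∀ s, 0 ≤ s - 1 → s ≤ m → Crosses p q f σ s 1 0)
  (h₂ : ∀ s, 0 ≤ s - 1 → s ≤ m → Crosses p q f σ s 0 1)

include hp hp0 hq hq0 hm h₁ h₂ in
-- The elementary relations hold only while the index stays in `[0, m]`. Opposite exponents leave
-- the index unchanged, so unit moves can alternate between `s` and one neighbour: `s - 1` in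
-- general, `s + 1` when `s = 0`.
lemma crosses_neg {s : ℤ} (hs : 0 ≤ s) (hs' : s ≤ m) (a : ℤ) : Crosses p q f σ s a (-a) := by
  have zig : Crosses p q f σ s 1 (-1) := by
    by_cases h : 0 ≤ s - 1
    · have := ((h₂ s h hs').symm hp hp0 hq hq0)
      refine (h₁ s h hs').trans (a' := 0) (b' := -1) hp hq ?_
      simpa using this
    · have := (h₂ (s + 1) (by lia) (by lia)).symm hp hp0 hq hq0
      refine Crosses.trans (a := 0) (b := -1) (a' := 1) (b' := 0) hp hq (by simpa using this) ?_
      simpa using h₁ (s + 1) (by lia) (by lia)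
  have nonneg : ∀ n : ℕ, Crosses p q f σ s n (-n) := fun n => by
    induction n with
    | zero => simpa using crosses_zero hp0 hq0 s
    | succ n ih =>
      have h := ih.trans (a' := 1) (b' := -1) hp hq (by simpa using zig)
      have e : -((n : ℤ) + 1) = -n + -1 := by ring
      rw [Nat.cast_succ, e]
      exact h
  obtain ⟨n, rfl | rfl⟩ := a.eq_nat_or_neg
  · exact nonneg n
  · simpa using (nonneg n).symm hp hp0 hq hq0

include hp hp0 hq hq0 hm h₁ h₂ in
-- Only the two end indices are required to be in range. Split `(a, b)` as `(a, -a)`, which does not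
-- move the index, followed by `(0, a + b)`, which moves it monotonically to its final value.
lemma crosses_of_range {s a b : ℤ} (hs : 0 ≤ s) (hs' : s ≤ m) (ht : 0 ≤ s - a - b)
    (ht' : s - a - b ≤ m) : Crosses p q f σ s a b := by
  have nonneg : ∀ (n : ℕ) (s : ℤ), s ≤ m → 0 ≤ s - n → Crosses p q f σ s 0 n := fun n => by
    induction n with
    | zero => exact fun s _ _ => crosses_zero hp0 hq0 s
    | succ n ih =>
      intro s hs hs'
      have h := (ih s hs (by lia)).trans (a' := 0) (b' := 1) hp hq
        (h₂ _ (by push_cast at hs'; lia) (by lia))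
      simpa using h
  have all : ∀ n : ℤ, 0 ≤ s - n → s - n ≤ m → Crosses p q f σ s 0 n := fun n hn hn' => by
    obtain ⟨n, rfl | rfl⟩ := n.eq_nat_or_neg
    · exact nonneg n s hs' hn
    · simpa using (nonneg n (s + n) (by lia) (by lia)).symm hp hp0 hq hq0
  have h := (crosses_neg hp hp0 hq hq0 hm h₁ h₂ hs hs' a).trans (a' := 0) (b' := a + b) hp hq
    (by simpa using all (a + b) (by lia) (by lia))
  simpa using h

end Crossing

variable {R : Pseudofunctor B Cat.{v₁, u₁}}

/-- Shifting is composition with the shifted identity, which is invertible with inverse the opposite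
shift. -/
lemma IsAdj.shift {X Y : IsoCat B} {x : X ⟶ Y} {y : Y ⟶ X} (h : IsAdj R x y) (n : ℤ) :
    IsAdj R (shift n x) (shift (-n) y) := by
  have := h.comp (IsAdj.of_inverse (R := R) (x := IsoCat.shift n (𝟙 Y))
    (y := IsoCat.shift (-n) (𝟙 Y)) (by simp) (by simp))
  simpa using this

end Triangulated

end IsoCat

/-- A direct sum is a retract of another one if each of its summands is zero or is isomorphic
to a summand of the latter, in an injective way. -/
lemma nonempty_retract_biproduct {C : Type*} [Category* C] [Preadditive C] [HasFiniteBiproducts C]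
    {J K : Type} [Finite J] [Finite K] (h : J → C) (g : K → C) (p : J → Prop)
    (hz : ∀ j, ¬ p j → IsZero (h j)) (e : ∀ j, p j → K) (iso : ∀ j hj, Nonempty (h j ≅ g (e j hj)))
    (inj : ∀ j hj j' hj', e j hj = e j' hj' → j = j') : Nonempty (Retract (⨁ h) (⨁ g)) := by
  classical
  let i : ⨁ h ⟶ ⨁ g := biproduct.desc fun j =>
    if hj : p j then (iso j hj).some.hom ≫ biproduct.ι g (e j hj) else 0
  let r : ⨁ g ⟶ ⨁ h := biproduct.lift fun j =>
    if hj : p j then biproduct.π g (e j hj) ≫ (iso j hj).some.inv else 0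
  refine ⟨⟨i, r, ?_⟩⟩
  refine biproduct.hom_ext' _ _ fun j => biproduct.hom_ext _ _ fun j' => ?_
  simp only [i, r, biproduct.ι_desc_assoc, Category.assoc, biproduct.lift_π, Category.comp_id]
  by_cases hj : p j
  · by_cases hj' : p j'
    · rw [dif_pos hj, dif_pos hj']
      by_cases hjj' : j = j'
      · subst hjj'
        simp
      · rw [biproduct.ι_π_ne _ hjj', Category.assoc,
          biproduct.ι_π_ne_assoc _ (fun he => hjj' (inj _ _ _ _ he)), zero_comp, comp_zero]
    · exact (hz j' hj').eq_of_tgt _ _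
  · exact (hz j hj).eq_of_src _ _

namespace CategoricalAction

open IsoCat

variable {N : ℕ} {B : Type u} [Bicategory.{w, v} B] [TriangulatedBicategory B]
  (A : CategoricalAction N B)

/-! ### The invertible 1-morphisms `(Ψ^+)^a (Ψ^-)^b` -/

/-- The class of `Ψ^ε`, as an automorphism. -/
def psiAut (ε : PM) (k : ℤ) (hk : 0 ≤ k) (hk' : k ≤ N) : Aut (⟨A.wt k⟩ : IsoCat B) where
  hom := cl (A.Psi ε PM.plus k)
  inv := cl (A.Psi ε PM.minus k)
  hom_inv_id := cl_eq_iff.2 (A.Psi_inv ε _ _ k hk hk' (by simp))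
  inv_hom_id := cl_eq_iff.2 (A.Psi_inv ε _ _ k hk hk' (by simp))

/-- The class of `(Ψ^+)^a (Ψ^-)^b`. -/
noncomputable def psi (k a b : ℤ) : (⟨A.wt k⟩ : IsoCat B) ⟶ ⟨A.wt k⟩ :=
  cl (zpow (A.Psi PM.plus PM.plus k) (A.Psi PM.plus PM.minus k) a) ≫
    cl (zpow (A.Psi PM.minus PM.plus k) (A.Psi PM.minus PM.minus k) b)

lemma psi_zero (k : ℤ) : A.psi k 0 0 = 𝟙 _ := Category.id_comp _

lemma psi_comp {k : ℤ} (hk : 0 ≤ k) (hk' : k ≤ N) (a b a' b' : ℤ) :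
    A.psi k a b ≫ A.psi k a' b' = A.psi k (a + a') (b + b') := by
  -- Multiplication in `Aut` reverses diagrammatic composition, hence the order of the two factors.
  have key : ∀ a b, A.psi k a b =
      (A.psiAut PM.minus k hk hk' ^ b * A.psiAut PM.plus k hk hk' ^ a).hom := fun a b => by
    rw [psi, cl_zpow (A.psiAut PM.plus k hk hk') rfl rfl,
      cl_zpow (A.psiAut PM.minus k hk hk') rfl rfl]
    rfl
  have comm : Commute (A.psiAut PM.minus k hk hk') (A.psiAut PM.plus k hk hk') :=
    Iso.ext (cl_eq_iff.2 (A.Psi_Psi PM.plus PM.plus PM.minus PM.plus k hk hk'))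
  rw [key, key, key]
  set p := A.psiAut PM.plus k hk hk'
  set m := A.psiAut PM.minus k hk hk'
  calc (m ^ b * p ^ a).hom ≫ (m ^ b' * p ^ a').hom
      = ((m ^ b' * p ^ a') * (m ^ b * p ^ a)).hom := rfl
    _ = _ := by
      congr 1
      rw [mul_assoc, ← mul_assoc (p ^ a'), ← (comm.zpow_zpow b a').eq, mul_assoc, ← mul_assoc,
        ← zpow_add, ← zpow_add, add_comm a, add_comm b]

lemma cl_zpow_plus (k a : ℤ) :
    cl (zpow (A.Psi PM.plus PM.plus k) (A.Psi PM.plus PM.minus k) a) = A.psi k a 0 :=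
  (Category.comp_id _).symm

lemma cl_zpow_minus (k b : ℤ) :
    cl (zpow (A.Psi PM.minus PM.plus k) (A.Psi PM.minus PM.minus k) b) = A.psi k 0 b :=
  (Category.id_comp _).symm

lemma cl_psi_plus (k : ℤ) : cl (A.Psi PM.plus PM.plus k) = A.psi k 1 0 :=
  ((Category.comp_id _).trans (Category.id_comp _)).symm

lemma cl_psi_minus (k : ℤ) : cl (A.Psi PM.minus PM.plus k) = A.psi k 0 1 :=
  ((Category.id_comp _).trans (Category.id_comp _)).symm

/-- `F_s (Ψ^+)^a (Ψ^-)^b`, in diagrammatic order. -/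
lemma F_psi {k l : ℤ} (h : k + 1 = l) (hk : 0 ≤ k) (hl : l ≤ N) {s a b : ℤ} (hs : FRange N k s)
    (hs' : FRange N k (s - a - b)) :
    cl (A.F s h) ≫ A.psi l a b = shift (a - b) (A.psi k a b ≫ cl (A.F (s - a - b) h)) := by
  have hk' : k ≤ N := by lia
  have := crosses_of_range (σ := 1) (f := fun s => cl (A.F s h)) (m := N - k + 1)
    (A.psi_comp hk hk') (A.psi_zero k) (A.psi_comp (k := l) (by lia) hl) (A.psi_zero l) (by lia)
    (fun s h₀ h₁ => by
      have := cl_eq_iff.2 (A.Psi_F PM.plus k l h s hk hk' ⟨by lia, by lia⟩ ⟨by lia, by lia⟩)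
      rw [cl_comp, cl_shift, cl_comp, cl_psi_plus, cl_psi_plus] at this
      simpa [Crosses, PM.val] using this)
    (fun s h₀ h₁ => by
      have := cl_eq_iff.2 (A.Psi_F PM.minus k l h s hk hk' ⟨by lia, by lia⟩ ⟨by lia, by lia⟩)
      rw [cl_comp, cl_shift, cl_comp, cl_psi_minus, cl_psi_minus] at this
      simpa [Crosses, PM.val] using this) hs.1 hs.2 hs'.1 hs'.2
  simpa [Crosses] using this

/-- `E_0 (Ψ^+)^a (Ψ^-)^{-a}`, in diagrammatic order. -/
lemma E_psi {k l : ℤ} (h : l + 1 = k) (hl : 0 ≤ l) (hk : k ≤ N) (a : ℤ) :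
    cl (A.E 0 h) ≫ A.psi l a (-a) = shift (-(2 * a)) (A.psi k a (-a) ≫ cl (A.E 0 h)) := by
  have hk₀ : 0 ≤ k := by lia
  -- Negating the index turns the range of `E` into `[0, k + 1]` and makes it drop under crossing,
  -- as for `F`. The shift changes sign, hence `σ = -1`. The exponents are opposite because index
  -- `0` has to be preserved.
  have := crosses_neg (σ := -1) (f := fun s => cl (A.E (-s) h)) (m := k + 1) (s := 0)
    (A.psi_comp hk₀ hk) (A.psi_zero k) (A.psi_comp (k := l) hl (by lia)) (A.psi_zero l) (by lia)
    (fun s h₀ h₁ => by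
      have := cl_eq_iff.2 (A.Psi_E PM.plus k l h (-s) hk₀ hk ⟨by lia, by lia⟩ ⟨by lia, by lia⟩)
      rw [cl_comp, cl_shift, cl_comp, cl_psi_plus, cl_psi_plus] at this
      have e : -(s - 1) = -s + 1 := by ring
      simpa [Crosses, PM.val, e] using this)
    (fun s h₀ h₁ => by
      have := cl_eq_iff.2 (A.Psi_E PM.minus k l h (-s) hk₀ hk ⟨by lia, by lia⟩ ⟨by lia, by lia⟩)
      rw [cl_comp, cl_shift, cl_comp, cl_psi_minus, cl_psi_minus] at this
      have e : -(s - 1) = -s + 1 := by ring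
      simpa [Crosses, PM.val, e] using this) le_rfl (by lia) a
  have e : -(a + a) = -(2 * a) := by ring
  simpa [Crosses, e] using this

/-! ### Adjoints of the generators -/

section Adjoints

variable (R : Pseudofunctor B Cat.{v₁, u₁})

lemma isAdj_E_zero {k l : ℤ} (h : l + 1 = k) (hk : 0 ≤ k) (hk' : k ≤ N) :
    IsAdj R (shift k (A.psi l 0 (-k) ≫ cl (A.F 0 h) ≫ A.psi k 0 (k - 1))) (cl (A.E 0 h)) := by
  obtain ⟨adj⟩ := A.E_leftAdjoint k l h 0 hk hk' ⟨by lia, le_rfl⟩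
  have := isAdj_cl.2 (MapAdj.of_adjunction (R := R) adj)
  rw [cl_shift, cl_comp, cl_comp, cl_zpow_minus, cl_zpow_minus] at this
  simpa using this

lemma isAdj_F {k l : ℤ} (h : k + 1 = l) (hk : 0 ≤ k) (hk' : k ≤ N) {s : ℤ} (hs : FRange N k s) :
    IsAdj R (shift (-s + N - k)
      (A.psi l (s - N + k) 0 ≫ cl (A.E 0 h) ≫ A.psi k (-s + N - k - 1) 0)) (cl (A.F s h)) := by
  obtain ⟨adj⟩ := A.F_leftAdjoint k l h s hk hk' hs
  have := isAdj_cl.2 (MapAdj.of_adjunction (R := R) adj)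
  rw [cl_shift, cl_comp, cl_comp, cl_zpow_plus, cl_zpow_plus] at this
  simpa using this

lemma isAdj_psi {k : ℤ} (hk : 0 ≤ k) (hk' : k ≤ N) (a b : ℤ) :
    IsAdj R (A.psi k a b) (A.psi k (-a) (-b)) :=
  IsAdj.of_inverse (by simp [A.psi_comp hk hk', psi_zero]) (by simp [A.psi_comp hk hk', psi_zero])

lemma exists_mapAdj_Fword {k : ℕ} (hk : k ≤ N) (l : Fin k → ℕ) (hl : ∀ i, l i + k ≤ N) :
    ∃ g, MapAdj R (A.Fword k l) g := by
  induction k with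
  | zero => exact ⟨𝟙 _, MapAdj.of_inverse ⟨Bicategory.leftUnitor _⟩ ⟨Bicategory.leftUnitor _⟩⟩
  | succ k ih =>
    obtain ⟨g, hg⟩ := ih (by lia) (fun i => l i.succ) fun i => by have := hl i.succ; lia
    have h0 := hl 0
    obtain ⟨adj⟩ := A.F_rightAdjoint k _ (Nat.cast_succ k).symm (l 0) (by lia) (by lia)
      ⟨by lia, by lia⟩
    exact ⟨_, hg.comp (MapAdj.of_adjunction adj)⟩

end Adjoints

/-! ### Words in the `F_s` -/

lemma cl_Fword_succ (k : ℕ) (l : Fin (k + 1) → ℕ) :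
    cl (A.Fword (k + 1) l) = cl (A.Fword k fun i => l i.succ) ≫ cl (A.Fn (l 0) k) := rfl

lemma eq_zero_of_not_weight {X : IsoCat B} {k : ℤ} (hk : ¬ (0 ≤ k ∧ k ≤ N)) (x : X ⟶ ⟨A.wt k⟩) :
    x = 0 := by
  have : 𝟙 (⟨A.wt k⟩ : IsoCat B) = 0 := cl_eq_zero_iff.2 (A.wt_zero k hk)
  rw [← Category.comp_id x, this, comp_zero]

/-- `E_0` kills a word in the `F_s` unless the first letter applied is `F_0`, and it then
cancels this letter up to `Ψ^-`. -/
lemma Fword_comp_E {k : ℕ} (hk : k + 1 ≤ N) (l : Fin (k + 1) → ℕ) (hl : ∀ i, l i + (k + 1) ≤ N) :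
    (l (Fin.last k) ≠ 0 → cl (A.Fword (k + 1) l) ≫ cl (A.En 0 k) = 0) ∧
    (l (Fin.last k) = 0 → cl (A.Fword (k + 1) l) ≫ cl (A.En 0 k) =
      shift (k - 1) (cl (A.Fword k fun i => l i.castSucc + 1) ≫ A.psi k 0 1)) := by
  induction k with
  | zero =>
    have h0 := hl 0
    have e : cl (A.Fword 1 l) ≫ cl (A.En 0 0) = cl (A.Fn (l 0) 0) ≫ cl (A.En 0 0) := by
      rw [cl_Fword_succ]
      exact congrArg (· ≫ cl (A.En 0 0)) (Category.id_comp _)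
    -- `F_s E_0` on weight `0` passes through the zero weight `-1`. So `E_0 F_s` vanishes for `s ≠
    -- 0`, and the triangle for `s = 0` leaves `Ψ^-[-1]`.
    have hz : ∀ s : ℤ, cl (A.E 0 (show (-1 : ℤ) + 1 = ((0 : ℕ) : ℤ) by simp) ≫
        A.F s (show (-1 : ℤ) + 1 = ((0 : ℕ) : ℤ) by simp)) = 0 := fun s => by
      rw [cl_comp, A.eq_zero_of_not_weight (by lia) (cl (A.E 0 _)), zero_comp]
    rw [e]
    refine ⟨fun h => ?_, fun h => ?_⟩
    · change l 0 ≠ 0 at h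
      exact (cl_eq_iff.2 (A.E_F_e _ (-1) _ (by simp) _ 0 (l 0) (by lia) (by lia)
        ⟨by lia, by lia⟩ ⟨by lia, by lia⟩ ⟨by lia, by lia⟩ ⟨by lia, by lia⟩ (by lia)
        (by lia))).symm.trans (hz _)
    · change l 0 = 0 at h
      have hT := A.E_F_c _ (-1) _ (by simp) (Nat.cast_succ 0).symm 0 0 (by lia) (by lia)
        ⟨by lia, by lia⟩ ⟨by lia, by lia⟩ ⟨by lia, by lia⟩ ⟨by lia, by lia⟩ (by lia)
      have := eq_shift_of_exactTriangle hT (hz 0)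
      rw [h]
      refine this.trans ?_
      rw [cl_psi_minus]
      change _ = shift _ (𝟙 _ ≫ _)
      rw [Category.id_comp]
      rfl
  | succ k ih =>
    have h0 := hl 0
    have ih := ih (by lia) (fun i => l i.succ) fun i => by have := hl i.succ; lia
    -- On a weight at least `1` the sum of indices `l 0` always lies in the commuting range,
    -- including `l 0 = 0`.
    have comm : cl (A.Fn (l 0) (k + 1)) ≫ cl (A.En 0 (k + 1)) =
        cl (A.En 0 k) ≫ cl (A.Fn (l 0) k) :=
      (cl_eq_iff.2 (A.E_F_e _ _ _ _ _ 0 (l 0) (by lia) (by lia)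
        ⟨by lia, by lia⟩ ⟨by lia, by lia⟩ ⟨by lia, by lia⟩ ⟨by lia, by lia⟩ (by lia)
        (by lia))).symm
    rw [cl_Fword_succ, Category.assoc, comm, ← Category.assoc]
    rw [Fin.succ_last] at ih
    refine ⟨fun h => by rw [ih.1 h, zero_comp], fun h => ?_⟩
    -- Carrying `Ψ^-` past a letter raises its index by one and contributes a shift by one. The `k`
    -- letters passed and the initial `[-1]` give the total `k - 1`.
    have cross := A.F_psi (Nat.cast_succ k).symm (by lia) (by lia) (s := l 0 + 1) (a := 0) (b := 1)
      ⟨by lia, by lia⟩ ⟨by lia, by lia⟩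
    rw [eq_comm, shift_eq_iff] at cross
    rw [ih.2 h, shift_comp, Category.assoc]
    have e : (l 0 : ℤ) + 1 - 0 - 1 = l 0 := by ring
    rw [e] at cross
    rw [cross, comp_shift, shift_shift, cl_Fword_succ, Category.assoc]
    simp only [Fin.castSucc_zero, Fin.succ_castSucc, Nat.cast_add, Nat.cast_one]
    congr 1
    ring

/-! ### The direct sums `φ_k` -/

/-- If the first row of `λ` is `N - k`, then `F_{N-k-1} F_{N-k} = 0` kills the word. Otherwise
`F_{N-k-1}` adds a new first row of the maximal length allowed in `P(N-k-1, k+1)`. -/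
lemma nonempty_retract_φ_comp_F {k : ℕ} (hk : k + 1 ≤ N) :
    Nonempty (Retract (A.φ k ≫ A.Fn ((N : ℤ) - k - 1) k) (A.φ (k + 1))) := by
  obtain ⟨r⟩ := nonempty_retract_biproduct
    (fun l : YoungIn (N - k) k => A.Fword k l.1 ≫ A.Fn ((N : ℤ) - k - 1) k)
    (fun l : YoungIn (N - (k + 1)) (k + 1) => A.Fword (k + 1) l.1)
    (fun l => ∀ i, l.1 i ≤ N - (k + 1))
    (fun l hl => by
      push Not at hl
      obtain ⟨i, hi⟩ := hl
      cases k with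
      | zero => exact i.elim0
      | succ k =>
        have h1 := l.2.2 0
        have h2 := l.2.1 (Fin.zero_le i)
        have h3 : (l.1 0 : ℤ) = (N : ℤ) - (k + 1 : ℕ) - 1 + 1 := by lia
        rw [← cl_eq_zero_iff, cl_comp, cl_Fword_succ, h3, Category.assoc]
        have := cl_eq_zero_iff.2 (A.F_F_of_eq k _ _ (Nat.cast_succ k).symm
          (Nat.cast_succ (k + 1)).symm ((N : ℤ) - (k + 1 : ℕ) - 1) (by lia) (by lia)
          ⟨by lia, by lia⟩ ⟨by lia, by lia⟩)
        rw [cl_comp] at this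
        rw [this, comp_zero])
    (fun l hl => ⟨Fin.cons (N - (k + 1)) l.1, by
      intro i j hij
      cases i using Fin.cases with
      | zero =>
        cases j using Fin.cases with
        | zero => exact le_rfl
        | succ j => simpa using hl j
      | succ i =>
        cases j using Fin.cases with
        | zero => exact absurd hij (by simp)
        | succ j => simpa using l.2.1 (Fin.succ_le_succ_iff.1 hij), by
      intro i
      cases i using Fin.cases with
      | zero => exact le_rfl
      | succ i => simpa using hl i⟩)
    (fun l hl => by
      rw [← cl_eq_iff, cl_comp, cl_Fword_succ]
      have e : (N : ℤ) - k - 1 = (N - (k + 1) : ℕ) := by lia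
      simp only [Fin.cons_succ, Fin.cons_zero, e])
    (fun l hl l' hl' h => Subtype.ext (Fin.cons_injective2 (α := fun _ => ℕ) (congrArg Subtype.val h)).2)
  exact ⟨(Retract.ofIso ((Bicategory.postcomp _ _).mapBiproduct _)).trans r⟩

/-- Only diagrams with empty last row survive `E_0`. For these, `Fword_comp_E` deletes that row and
lengthens every other row by one, which is injective and lands in `P(N-k, k)`. -/
lemma nonempty_retract_φ_comp_E {k : ℕ} (hk : k + 1 ≤ N) {x : A.ob k ⟶ A.ob k}
    (hx : cl x = shift (k - 1) (A.psi k 0 1)) :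
    Nonempty (Retract (A.φ (k + 1) ≫ A.En 0 k) (A.φ k ≫ x)) := by
  have hl : ∀ (l : YoungIn (N - (k + 1)) (k + 1)) i, l.1 i + (k + 1) ≤ N := fun l i => by
    have := l.2.2 i
    lia
  obtain ⟨r⟩ := nonempty_retract_biproduct
    (fun l : YoungIn (N - (k + 1)) (k + 1) => A.Fword (k + 1) l.1 ≫ A.En 0 k)
    (fun l : YoungIn (N - k) k => A.Fword k l.1 ≫ x)
    (fun l => l.1 (Fin.last k) = 0)
    (fun l h => cl_eq_zero_iff.1 ((A.Fword_comp_E hk l.1 (hl l)).1 h))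
    (fun l _ => ⟨fun i => l.1 i.castSucc + 1,
      fun i j hij => Nat.succ_le_succ (l.2.1 (Fin.castSucc_le_castSucc_iff.2 hij)),
      fun i => by have := hl l i.castSucc; lia⟩)
    (fun l h => by
      rw [← cl_eq_iff, cl_comp, cl_comp, (A.Fword_comp_E hk l.1 (hl l)).2 h, hx, comp_shift])
    (fun l h l' h' he => Subtype.ext (funext fun i => by
      cases i using Fin.lastCases with
      | last => rw [h, h']
      | cast i => exact Nat.succ_injective (congrFun (congrArg Subtype.val he) i)))
  exact ⟨((Retract.ofIso ((Bicategory.postcomp _ _).mapBiproduct _)).trans r).trans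
    (Retract.ofIso ((Bicategory.postcomp _ x).mapBiproduct _).symm)⟩

end CategoricalAction

/-- Objectwise isomorphisms suffice, and `mapShiftIso` compares a shifted 1-morphism with a shifted
functor one object at a time. -/
lemma IsTExact.of_iso {C : Type*} [Category* C] [Preadditive C] [HasZeroObject C] [HasShift C ℤ]
    [∀ n : ℤ, (shiftFunctor C n).Additive] [Pretriangulated C]
    {D : Type*} [Category* D] [Preadditive D] [HasZeroObject D] [HasShift D ℤ]
    [∀ n : ℤ, (shiftFunctor D n).Additive] [Pretriangulated D]
    {t₁ : TStructure C} {t₂ : TStructure D} {G G' : C ⥤ D} (h : IsTExact t₁ t₂ G)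
    (e : ∀ X, Nonempty (G.obj X ≅ G'.obj X)) : IsTExact t₁ t₂ G' :=
  ⟨fun X hX => (t₂.le 0).prop_of_iso (e X).some (h.1 X hX),
    fun X hX => (t₂.ge 0).prop_of_iso (e X).some (h.2 X hX)⟩

/-! ### Exactness criterion and change of the inducing 1-morphism -/

section Induces

variable {B : Type u} [Bicategory.{w, v} B] [TriangulatedBicategory B]
  {R : Pseudofunctor B Cat.{v₁, u₁}} [TriangulatedRealization R]

/-- The t-structure `t` is induced from `t₀` by the right adjoint of the functor attached
to `f`. -/
def Induces {a b : B} (f : a ⟶ b) (t₀ : TStructure (R.obj a)) (t : TStructure (R.obj b)) : Prop :=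
  (R.map f).toFunctor.IsLeftAdjoint ∧
    ∀ G : R.obj b ⥤ R.obj a, Nonempty ((R.map f).toFunctor ⊣ G) → ∀ X : R.obj b,
      (t.le 0 X ↔ t₀.le 0 (G.obj X)) ∧ (t.ge 0 X ↔ t₀.ge 0 (G.obj X))

/-- Passing to right adjoints makes `f^R (l X)` a retract of `g^R X`, and both halves of a
t-structure are closed under retracts. -/
lemma Induces.isTExact {a b c : B} {f : a ⟶ b} {g : a ⟶ c} {t₀ : TStructure (R.obj a)}
    {t : TStructure (R.obj b)} {t' : TStructure (R.obj c)} (hf : Induces f t₀ t)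
    (hg : Induces g t₀ t') {m : b ⟶ c} {l : c ⟶ b} (h : MapAdj R m l)
    (r : Nonempty (Retract (f ≫ m) g)) : IsTExact t' t (R.map l).toFunctor := by
  have := hf.1
  have := hg.1
  let adj := Adjunction.ofIsLeftAdjoint (R.map f).toFunctor
  let adj' := Adjunction.ofIsLeftAdjoint (R.map g).toFunctor
  have hr := fun X => h.nonempty_retract r.some adj adj' X
  exact ⟨fun X hX => (hf.2 _ ⟨adj⟩ _).1.2 (le_of_retract (hr X).some ((hg.2 _ ⟨adj'⟩ X).1.1 hX)),
    fun X hX => (hf.2 _ ⟨adj⟩ _).2.2 (ge_of_retract (hr X).some ((hg.2 _ ⟨adj'⟩ X).2.1 hX))⟩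

/-- The right adjoint of `f ≫ u` is that of `f` precomposed with the equivalence given by `v`, so
the t-structure is pulled back along `v`. -/
lemma Induces.comp {a b : B} {f f' : a ⟶ b} {u v : b ⟶ b} (e : Nonempty (u ≫ v ≅ 𝟙 b))
    (e' : Nonempty (v ≫ u ≅ 𝟙 b)) (hf' : Nonempty (f ≫ u ≅ f')) {t₀ : TStructure (R.obj a)}
    {t : TStructure (R.obj b)} (hf : Induces f t₀ t) :
    ∃ t' : TStructure (R.obj b), Induces f' t₀ t' := by
  have := hf.1
  let adj := Adjunction.ofIsLeftAdjoint (R.map f).toFunctor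
  have : (R.map v).toFunctor.IsEquivalence := (mapEquivalence e'.some e.some).isEquivalence_functor
  let adj' := (adj.comp (MapAdj.of_inverse (R := R) e e').some).ofNatIsoLeft
    ((mapCompIso R f u).symm ≪≫ mapIso R hf'.some)
  obtain ⟨t', ht'⟩ := exists_tStructure_of_equivalence t (R.map v).toFunctor
  refine ⟨t', adj'.isLeftAdjoint, fun G ⟨adjG⟩ X => ?_⟩
  have h := hf.2 _ ⟨adj⟩ ((R.map v).toFunctor.obj X)
  have e := (adj'.rightAdjointUniq adjG).app X
  exact ⟨((ht' 0 X).1.trans h.1).trans ((t₀.le 0).prop_iff_of_iso e),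
    ((ht' 0 X).2.trans h.2).trans ((t₀.ge 0).prop_iff_of_iso e)⟩

end Induces

lemma IsoCat.nonempty_retract {B : Type u} [Bicategory.{w, v} B] {a b : B} {f f' g g' : a ⟶ b}
    (hf : IsoCat.cl f = IsoCat.cl f') (hg : IsoCat.cl g = IsoCat.cl g')
    (r : Nonempty (Retract f g)) : Nonempty (Retract f' g') := by
  obtain ⟨e⟩ := IsoCat.cl_eq_iff.1 hf
  obtain ⟨e'⟩ := IsoCat.cl_eq_iff.1 hg
  obtain ⟨r⟩ := r
  exact ⟨((Retract.ofIso e.symm).trans r).trans (Retract.ofIso e')⟩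

/-! ### The twisted sums `φ'_k` and the adjoints of the generators -/

namespace CategoricalAction

open IsoCat

variable {N : ℕ} {B : Type u} [Bicategory.{w, v} B] [TriangulatedBicategory B]
  (A : CategoricalAction N B)

lemma psi_comp_assoc {k : ℤ} (hk : 0 ≤ k) (hk' : k ≤ N) (a b a' b' : ℤ) {Y : IsoCat B}
    (x : ⟨A.wt k⟩ ⟶ Y) :
    A.psi k a b ≫ A.psi k a' b' ≫ x = A.psi k (a + a') (b + b') ≫ x := by
  rw [← Category.assoc, A.psi_comp hk hk']

lemma cl_φ' {k : ℕ} (hk : k ≤ N) :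
    cl (A.φ' k) = cl (A.φ k) ≫ shift ((k : ℤ) * ((N : ℤ) - k) - N) (A.psi k k ((N : ℤ) - k)) := by
  have h₁ : cl (npow (A.Psi PM.plus PM.plus k) k) = A.psi k k 0 := A.cl_zpow_plus k k
  have h₂ : cl (npow (A.Psi PM.minus PM.plus k) (N - k)) = A.psi k 0 ((N : ℤ) - k) := by
    rw [← Nat.cast_sub hk]
    exact A.cl_zpow_minus k ((N - k : ℕ) : ℤ)
  rw [φ', cl_shift, cl_comp, cl_comp, h₁, h₂, Category.assoc, A.psi_comp (by lia) (by lia)]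
  simp

section

variable (R : Pseudofunctor B Cat.{v₁, u₁})

/-- A left adjoint `m` of the left adjoint `l` of `F_{N-k-1}`, and the composite `φ'_k m`. -/
lemma exists_adjoints_F {k : ℕ} (hk : k + 1 ≤ N) :
    ∃ (l : A.ob (k + 1) ⟶ A.ob k) (m : A.ob k ⟶ A.ob (k + 1)),
      MapAdj R l (A.Fn ((N : ℤ) - k - 1) k) ∧ MapAdj R m l ∧
      Nonempty (Retract (A.φ' k ≫ m) (A.φ' (k + 1))) := by
  have hE := A.isAdj_E_zero R (Nat.cast_succ k).symm (by lia) (by lia)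
  have hF := A.isAdj_F R (Nat.cast_succ k).symm (by lia) (by lia) (s := (N : ℤ) - k - 1)
    ⟨by lia, by lia⟩
  have hm := (hE.comp (A.isAdj_psi R (by lia) (by lia) 1 0)).shift (-1)
  obtain ⟨l, hl⟩ := exists_rep (shift (-(-1)) (A.psi (k + 1 : ℕ) (-1) (-0) ≫ cl (A.En 0 k)))
  obtain ⟨m, hm'⟩ := exists_rep (shift (-1) (shift ((k + 1 : ℕ) : ℤ)
    (A.psi k 0 (-((k + 1 : ℕ) : ℤ)) ≫ cl (A.Fn 0 k) ≫ A.psi (k + 1 : ℕ) 0 ((k + 1 : ℕ) - 1)) ≫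
      A.psi (k + 1 : ℕ) 1 0))
  refine ⟨l, m, isAdj_cl.1 ?_, isAdj_cl.1 ?_, ?_⟩
  · rw [hl]
    convert hF using 1
    have e₁ : -((N : ℤ) - k - 1) + N - k = 1 := by ring
    have e₂ : (N : ℤ) - k - 1 - N + k = -1 := by ring
    rw [e₁, e₂]
    simp [psi_zero]
  · rw [hl, hm']
    exact hm
  · obtain ⟨r⟩ := A.nonempty_retract_φ_comp_F hk
    -- `x` is the invertible factor of `φ'_{k+1}`, so it remains to identify `φ'_k` followed by `m`
    -- with `φ_k`, then `F_{N-k-1}`, then `x`.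
    obtain ⟨x, hx⟩ := exists_rep (shift (((k + 1 : ℕ) : ℤ) * ((N : ℤ) - (k + 1 : ℕ)) - N)
      (A.psi (k + 1 : ℕ) (k + 1 : ℕ) ((N : ℤ) - (k + 1 : ℕ))))
    refine IsoCat.nonempty_retract ?_ ?_ ⟨r.map (Bicategory.postcomp _ x)⟩
    -- The exponents are what precedes `F_0`: `k` and `N - k` from `φ'_k`, with `k + 1` subtracted
    -- from the second by the adjoint of `E_0`. Their sum `N - k - 1` is exactly the index gap
    -- between `F_{N-k-1}` and `F_0`.
    · have cross := A.F_psi (Nat.cast_succ k).symm (by lia) (by lia) (s := (N : ℤ) - k - 1)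
        (a := k) (b := (N : ℤ) - 2 * k - 1) ⟨by lia, by lia⟩ ⟨by lia, by lia⟩
      rw [eq_comm, shift_eq_iff] at cross
      have e : (N : ℤ) - k - 1 - k - (N - 2 * k - 1) = 0 := by ring
      rw [e] at cross
      change cl ((A.φ k ≫ A.Fn ((N : ℤ) - k - 1) k) ≫ x) = _
      rw [cl_comp, cl_comp, cl_comp, hx, hm', A.cl_φ' (by lia)]
      simp only [shift_comp, comp_shift, shift_shift, Category.assoc]
      rw [A.psi_comp (k := (k + 1 : ℕ)) (by lia) (by lia),
        A.psi_comp_assoc (k := k) (by lia) (by lia)]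
      have e' : (N : ℤ) - k + -((k + 1 : ℕ) : ℤ) = N - 2 * k - 1 := by push_cast; ring
      rw [add_zero, e', ← Category.assoc (A.psi _ _ _), cross]
      simp only [shift_comp, comp_shift, shift_shift, Category.assoc]
      rw [A.psi_comp (k := (k + 1 : ℕ)) (by lia) (by lia)]
      congr 1
      · push_cast; ring
      · congr 3
        push_cast; ring
    · change cl (A.φ (k + 1) ≫ x) = _
      rw [cl_comp, hx, A.cl_φ' hk]

/-- The left adjoint `e` of `E_0`, and a left adjoint `m` of `e Ψ^- [k - 1]`. -/
lemma exists_adjoints_E {k : ℕ} (hk : k + 1 ≤ N) :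
    ∃ (e : A.ob k ⟶ A.ob (k + 1)) (m : A.ob (k + 1) ⟶ A.ob k),
      MapAdj R e (A.En 0 k) ∧
      MapAdj R m ((A.Psi PM.minus PM.plus k ≫ e)⟦((k + 1 : ℕ) : ℤ) - 2⟧) ∧
      Nonempty (Retract (A.φ' (k + 1) ≫ m) (A.φ' k)) := by
  have hE := A.isAdj_E_zero R (Nat.cast_succ k).symm (by lia) (by lia)
  have hF := A.isAdj_F R (Nat.cast_succ k).symm (by lia) (by lia) (s := 0) ⟨by lia, by lia⟩
  -- The formula for `(E_0)^L` turns `e Ψ^- [k-1]` into `(Ψ^-)^k F_0 (Ψ^-)^{-k} [2k]`. Its left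
  -- adjoint is the same conjugate of `(F_0)^L`, shifted by `-2k`.
  have hm := (((A.isAdj_psi R (k := (k + 1 : ℕ)) (by lia) (by lia) 0 (-k)).comp hF).comp
    (A.isAdj_psi R (k := k) (by lia) (by lia) 0 k)).shift (-(2 * k))
  obtain ⟨e, he⟩ := exists_rep (shift ((k + 1 : ℕ) : ℤ)
    (A.psi k 0 (-((k + 1 : ℕ) : ℤ)) ≫ cl (A.Fn 0 k) ≫ A.psi (k + 1 : ℕ) 0 ((k + 1 : ℕ) - 1)))
  obtain ⟨m, hm'⟩ := exists_rep (shift (-(2 * k)) ((A.psi (k + 1 : ℕ) 0 (-k) ≫ shift (-0 + N - k)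
    (A.psi (k + 1 : ℕ) (0 - N + k) 0 ≫ cl (A.En 0 k) ≫ A.psi k (-0 + N - k - 1) 0)) ≫ A.psi k 0 k))
  refine ⟨e, m, isAdj_cl.1 ?_, isAdj_cl.1 ?_, ?_⟩
  · rw [he]
    exact hE
  · rw [hm', cl_shift, cl_comp, he, cl_psi_minus]
    convert hm using 1
    simp only [comp_shift, shift_shift]
    rw [A.psi_comp_assoc (k := k) (by lia) (by lia)]
    congr 1
    · push_cast; ring
    · congr 2
      · push_cast; ring
      · congr 1
        push_cast; ring
  · obtain ⟨y, hy⟩ := exists_rep (shift ((k : ℤ) - 1) (A.psi k 0 1))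
    obtain ⟨r⟩ := A.nonempty_retract_φ_comp_E hk hy
    -- `x` is the invertible factor of `φ'_k` with the `Ψ^-[k-1]` produced by `E_0` taken out.
    obtain ⟨x, hx⟩ := exists_rep (shift ((k : ℤ) * ((N : ℤ) - k) - N - (k - 1))
      (A.psi k k ((N : ℤ) - k - 1)))
    refine IsoCat.nonempty_retract ?_ ?_ ⟨r.map (Bicategory.postcomp _ x)⟩
    -- The twist of `φ'_{k+1}` combines with the factors of `m` preceding `E_0` into exactly
    -- opposite powers of `Ψ^+` and `Ψ^-`, so `E_0` keeps its index.
    · have cross := A.E_psi (Nat.cast_succ k).symm (by lia) (by lia) (2 * k + 1 - N)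
      rw [eq_comm, shift_eq_iff] at cross
      change cl ((A.φ (k + 1) ≫ A.En 0 k) ≫ x) = _
      rw [cl_comp, cl_comp, cl_comp, hx, hm', A.cl_φ' hk]
      simp only [shift_comp, comp_shift, shift_shift, Category.assoc]
      rw [A.psi_comp (k := k) (by lia) (by lia),
        A.psi_comp_assoc (k := (k + 1 : ℕ)) (by lia) (by lia),
        A.psi_comp_assoc (k := (k + 1 : ℕ)) (by lia) (by lia)]
      have e₁ : ((k + 1 : ℕ) : ℤ) + 0 + (0 - N + k) = 2 * k + 1 - N := by push_cast; ring
      have e₂ : (N : ℤ) - (k + 1 : ℕ) + -k + 0 = -(2 * k + 1 - N) := by push_cast; ring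
      rw [e₁, e₂, ← Category.assoc (A.psi _ _ _), cross]
      simp only [shift_comp, comp_shift, shift_shift, Category.assoc]
      rw [A.psi_comp (k := k) (by lia) (by lia)]
      congr 1
      · push_cast; ring
      · congr 3
        · ring
        · ring
    · change cl ((A.φ k ≫ y) ≫ x) = _
      rw [cl_comp, cl_comp, hx, hy, A.cl_φ' (by lia)]
      simp only [shift_comp, comp_shift, shift_shift, Category.assoc]
      rw [A.psi_comp (k := k) (by lia) (by lia)]
      congr 1
      · ring
      · congr 2
        · ring
        · ring

end

section TStructures

variable {R : Pseudofunctor B Cat.{v₁, u₁}} [TriangulatedRealization R]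

lemma nonempty_φ_zero_iso : Nonempty (A.φ 0 ≅ 𝟙 _) := by
  let : Unique (YoungIn (N - 0) 0) :=
    { default := ⟨fun i => i.elim0, fun i => i.elim0, fun i => i.elim0⟩
      uniq := fun l => Subtype.ext (funext fun i => i.elim0) }
  exact ⟨biproductUniqueIso _⟩

lemma exists_induces_φ {k : ℕ} (hk : k ≤ N)
    (hgen : 1 ≤ k → WeaklyGenerates fun X : R.obj (A.ob 0) => (R.map (A.φ k)).toFunctor.obj X)
    (t₀ : TStructure (R.obj (A.ob 0)))
    (hexact : 1 ≤ k → ∀ (l m : YoungIn (N - k) k) (G : R.obj (A.ob k) ⥤ R.obj (A.ob 0)),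
      Nonempty ((R.map (A.Fword k l.1)).toFunctor ⊣ G) →
        IsTExact t₀ t₀ ((R.map (A.Fword k m.1)).toFunctor ⋙ G))
    (hext : 1 ≤ k → ∀ G : R.obj (A.ob k) ⥤ R.obj (A.ob 0),
      Nonempty ((R.map (A.φ k)).toFunctor ⊣ G) → Nonempty (CocompleteExtension.{v', u'} G)) :
    ∃ t : TStructure (R.obj (A.ob k)), Induces (A.φ k) t₀ t := by
  cases k with
  | zero =>
    -- For `k = 0` the only diagram is empty, so `φ_0` is the identity and `t₀` itself is induced.
    obtain ⟨e⟩ := A.nonempty_φ_zero_iso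
    let adj := Adjunction.id.ofNatIsoLeft ((mapIdIso R (A.ob 0)).symm ≪≫ mapIso R e.symm)
    refine ⟨t₀, adj.isLeftAdjoint, fun G ⟨adjG⟩ X => ?_⟩
    have i := (adj.rightAdjointUniq adjG).app X
    exact ⟨(t₀.le 0).prop_iff_of_iso i, (t₀.ge 0).prop_iff_of_iso i⟩
  | succ k =>
    let := Fintype.ofFinite (YoungIn (N - (k + 1)) (k + 1))
    let s := isDirectSumMap (R := R) fun l : YoungIn (N - (k + 1)) (k + 1) => A.Fword (k + 1) l.1
    have hF : ∀ l : YoungIn (N - (k + 1)) (k + 1),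
        (R.map (A.Fword (k + 1) l.1)).toFunctor.IsLeftAdjoint := fun l => by
      obtain ⟨g, ⟨adj⟩⟩ := A.exists_mapAdj_Fword R hk l.1 fun i => by
        have := l.2.2 i
        lia
      exact adj.isLeftAdjoint
    obtain ⟨T, ⟨adjT⟩, -⟩ := s.exists_rightAdjoint fun l =>
      Adjunction.ofIsLeftAdjoint (R.map (A.Fword (k + 1) l.1)).toFunctor
    obtain ⟨t, ht⟩ := exists_tStructure_of_isDirectSum s t₀ hF (hgen (by lia)) (hexact (by lia))
      (hext (by lia))
    exact ⟨t, adjT.isLeftAdjoint, fun G hG X => ht G hG 0 X⟩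

lemma exists_induces_φ' {k : ℕ} (hk : k ≤ N) {t₀ : TStructure (R.obj (A.ob 0))}
    {t : TStructure (R.obj (A.ob k))} (ht : Induces (A.φ k) t₀ t) :
    ∃ t' : TStructure (R.obj (A.ob k)), Induces (A.φ' k) t₀ t' := by
  obtain ⟨x, hx⟩ := exists_rep (shift ((k : ℤ) * ((N : ℤ) - k) - N) (A.psi k k ((N : ℤ) - k)))
  obtain ⟨y, hy⟩ := exists_rep
    (shift (-((k : ℤ) * ((N : ℤ) - k) - N)) (A.psi k (-k) (-((N : ℤ) - k))))
  refine ht.comp (u := x) (v := y) (cl_eq_iff.1 ?_) (cl_eq_iff.1 ?_) (cl_eq_iff.1 ?_)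
  · rw [cl_comp, hx, hy, shift_comp, comp_shift, A.psi_comp (by lia) (by lia), add_neg_cancel,
      add_neg_cancel, psi_zero, shift_shift, add_neg_cancel, shift_zero]
    rfl
  · rw [cl_comp, hx, hy, shift_comp, comp_shift, A.psi_comp (by lia) (by lia), neg_add_cancel,
      neg_add_cancel, psi_zero, shift_shift, neg_add_cancel, shift_zero]
    rfl
  · rw [cl_comp, hx, A.cl_φ' hk]

end TStructures

end CategoricalAction

end ShiftedAffine

theorem corollary8 {N : ℕ} {B : Type u} [Bicategory.{w, v} B]
    [ShiftedAffine.TriangulatedBicategory B]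
    (A : ShiftedAffine.CategoricalAction N B)
    (R : Pseudofunctor B Cat.{v₁, u₁}) [ShiftedAffine.TriangulatedRealization R]
    -- the image of `φ_k` weakly generates
    (hgen : ∀ k : ℕ, 1 ≤ k → k ≤ N →
      ShiftedAffine.WeaklyGenerates
        (fun X : R.obj (A.ob 0) => (R.map (A.φ k)).toFunctor.obj X))
    -- the t-structure on the highest weight category
    (t₀ : TStructure (R.obj (A.ob 0)))
    -- `(F_l)^R F_m` is t-exact
    (hexact : ∀ k : ℕ, 1 ≤ k → k ≤ N → ∀ (l m : ShiftedAffine.YoungIn (N - k) k)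
      (G : R.obj (A.ob k) ⥤ R.obj (A.ob 0)),
      Nonempty ((R.map (A.Fword k l.1)).toFunctor ⊣ G) →
        ShiftedAffine.IsTExact t₀ t₀ ((R.map (A.Fword k m.1)).toFunctor ⋙ G))
    -- standing assumption: the right adjoint of `φ_k` extends to cocomplete categories
    (hext : ∀ k : ℕ, 1 ≤ k → k ≤ N → ∀ G : R.obj (A.ob k) ⥤ R.obj (A.ob 0),
      Nonempty ((R.map (A.φ k)).toFunctor ⊣ G) →
        Nonempty (ShiftedAffine.CocompleteExtension.{v', u'} G)) :
    ∃ t : ∀ k : ℕ, k ≤ N → TStructure (R.obj (A.ob k)),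
      -- the t-structures are induced by the right adjoints of the `φ'_k`
      (∀ (k : ℕ) (hk : k ≤ N),
        (R.map (A.φ' k)).toFunctor.IsLeftAdjoint ∧
        ∀ G : R.obj (A.ob k) ⥤ R.obj (A.ob 0), Nonempty ((R.map (A.φ' k)).toFunctor ⊣ G) →
          ∀ X : R.obj (A.ob k),
            ((t k hk).le 0 X ↔ t₀.le 0 (G.obj X)) ∧ ((t k hk).ge 0 X ↔ t₀.ge 0 (G.obj X))) ∧
      -- `(F_{N-k-1} 1_(k,N-k))^L` is t-exact, for `0 ≤ k ≤ N - 1`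
      (∀ (k : ℕ) (hk : k + 1 ≤ N),
        (R.map (A.Fn ((N : ℤ) - k - 1) k)).toFunctor.IsRightAdjoint ∧
        ∀ L : R.obj (A.ob (k + 1)) ⥤ R.obj (A.ob k),
          Nonempty (L ⊣ (R.map (A.Fn ((N : ℤ) - k - 1) k)).toFunctor) →
            ShiftedAffine.IsTExact (t (k + 1) hk) (t k (Nat.le_of_succ_le hk)) L) ∧
      -- `(E 1_(k,N-k))^L Ψ^- [k-2]` is t-exact, for `1 ≤ k ≤ N`; here `k` is `j + 1`
      (∀ (j : ℕ) (hj : j + 1 ≤ N),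
        (R.map (A.En 0 j)).toFunctor.IsRightAdjoint ∧
        ∀ L : R.obj (A.ob j) ⥤ R.obj (A.ob (j + 1)),
          Nonempty (L ⊣ (R.map (A.En 0 j)).toFunctor) →
            ShiftedAffine.IsTExact (t j (Nat.le_of_succ_le hj)) (t (j + 1) hj)
              (((R.map (A.Psi ShiftedAffine.PM.minus ShiftedAffine.PM.plus j)).toFunctor ⋙ L) ⋙
                shiftFunctor (R.obj (A.ob (j + 1))) (((j + 1 : ℕ) : ℤ) - 2))) := by
  have ht : ∀ (k : ℕ) (_ : k ≤ N), ∃ t : TStructure (R.obj (A.ob k)),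
      ShiftedAffine.Induces (A.φ' k) t₀ t := fun k hk => by
    obtain ⟨t, h⟩ := A.exists_induces_φ hk (fun h => hgen k h hk) t₀ (fun h => hexact k h hk)
      (fun h => hext k h hk)
    exact A.exists_induces_φ' hk h
  choose t ht using ht
  refine ⟨t, ht, fun k hk => ?_, fun k hk => ?_⟩
  · obtain ⟨l, m, ⟨adj⟩, hm, r⟩ := A.exists_adjoints_F R hk
    refine ⟨adj.isRightAdjoint, fun L ⟨adjL⟩ => ?_⟩
    exact ((ht k _).isTExact (ht (k + 1) hk) hm r).of_iso fun X =>
      ⟨(adj.leftAdjointUniq adjL).app X⟩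
  · obtain ⟨e, m, ⟨adj⟩, hm, r⟩ := A.exists_adjoints_E R hk
    refine ⟨adj.isRightAdjoint, fun L ⟨adjL⟩ => ?_⟩
    exact ((ht (k + 1) hk).isTExact (ht k _) hm r).of_iso fun X =>
      ⟨ShiftedAffine.mapShiftIso _ _ X ≪≫ (shiftFunctor _ _).mapIso
        ((ShiftedAffine.mapCompIso R _ _).app X ≪≫ (adj.leftAdjointUniq adjL).app _)⟩
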